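/- Let $q(t)\in\mathbb{C}[t]$ be a polynomial of degree $n\ge 4$. Put $\rho=2q(-\tfrac12)$ and $p(t)=\dfrac{-4q(t)q(-t-1)+\rho^2}{(1+2t)^2}\in\mathbb{C}[t]$, and let $p_0,p_1\in\mathbb{C}[t]$ be determined by $p(t)=p_0(t^2)+p_1(t^2)\,t$. Let $D(q)$ be the unital associative $\mathbb{C}$-algebra with generators $u,v,w$ and defining relations $$[u,v]=2w+v,\quad [u,w]=2vu+w+\rho,\quad [v,w]=-v^2-p_1(u),\quad w^2=v^2u+vw+\rho v+p_0(u).$$ Let $\mathbb{C}(x)\#\mathbb{Z}$ be the skew group algebra in which $\mathbb{Z}$, written multiplicatively with generator $\delta$, acts on $\mathbb{C}(x)$ by $\delta(f(x))=f(x-1)$, so that $\delta x=(x-1)\delta$. Let $S_2=\{1,\tau\}$ act on it by $\mathbb{C}$-algebra automorphisms with $\tau(x)=-x$, $\tau(\delta)=\delta^{-1}$, and let $(\mathbb{C}(x)\#\mathbb{Z})^{S_2}$ be the subalgebra of invariants. Let $\mathbb{C}(x)\#\mathbb{Z}$ act on $\mathbb{C}(x)$ naturally, by $\big(\sum_k f_k\delta^k\big)\cdot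 g=\sum_k f_k\,\delta^k(g)$. Then there is a $\mathbb{C}$-algebra homomorphism $\phi:D(q)\to(\mathbb{C}(x)\#\mathbb{Z})^{S_2}$ with the following properties. (i) $\phi$ is injective, and $$\phi(u)=x^2,$$ $$\phi(-v-w)=\frac12\Big(\frac{q(x)}{\frac12+x}\delta^{-1}+\frac{q(-x)}{\frac12-x}\delta-\frac{q(-\frac12)}{(\frac12+x)(\frac12-x)}\Big),$$ $$\phi(-\tfrac12v-w)=\frac12\Big(\frac{q(x)}{x}\delta^{-1}+\frac{q(-x)}{-x}\delta\Big).$$ (ii) $\mathbb{C}(x^2)\,\phi(D(q))=(\mathbb{C}(x)\#\mathbb{Z})^{S_2}=\phi(D(q))\,\mathbb{C}(x^2)$, where a product of two subspaces is the linear span of the products of their elements. (iii) Every element of $\phi(D(q))$ lies in the subalgebra of those elements of $(\mathbb{C}(x)\#\mathbb{Z})^{S_2}$ that map $\mathbb{C}[x^2]$ into itself. Moreover $\phi(D(q))$ is a principal Galois order in $(\mathbb{C}(x)\#\mathbb{Z})^{S_2}$ with respect to $\Lambda=\mathbb{C}[x]$, $L=\mathbb{C}(x)$, $\mathcal{M}=\langle\delta\rangle$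 and $W=S_2$, in the following sense. Let $\Lambda$ be a noetherian integrally closed domain with field of fractions $L$, $\mathcal{M}$ a monoid acting faithfully on $\Lambda$ (hence also on $L$) by ring automorphisms, $\mathcal{L}=L\#\mathcal{M}$ the skew monoid ring, acting naturally on $L$, and $W$ a finite group acting faithfully on $\mathcal{L}$ by ring automorphisms that preserve $\Lambda$ and $\mathcal{M}$. A subring $U$ of $\mathcal{L}^W$ containing $\Lambda^W$ is a principal Galois order if every $X\in U$ maps $\Lambda^W$ into itself and $L^WU=\mathcal{L}^W$. -/

import Mathlib

open Polynomial

noncomputable section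

/-! ### Principal Galois orders -/

namespace GaloisOrder

variable {L M : Type*} [Field L] [Monoid M] [MulSemiringAction M L]

/-- The natural action of the skew monoid ring `L # M` on `L`:
`(∑ μ, a μ • μ) · f = ∑ μ, a μ * μ(f)`. -/
def natAct : SkewMonoidAlgebra L M →+* AddMonoid.End L :=
  SkewMonoidAlgebra.liftNCRingHom (Module.toAddMonoidEnd L L)
    (DistribMulAction.toAddMonoidEnd M L) (by
      intro a μ
      ext f
      exact (smul_mul' μ a f).symm)

@[simp]
theorem natAct_single (μ : M) (a f : L) :
    natAct (SkewMonoidAlgebra.single μ a) f = a * μ • f := by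
  have h : natAct (SkewMonoidAlgebra.single μ a) =
      Module.toAddMonoidEnd L L a * DistribMulAction.toAddMonoidEnd M L μ :=
    SkewMonoidAlgebra.liftNC_single _ _ μ a
  rw [h]
  rfl

/-- The embedding of the coefficient field `L` into `L # M`. -/
abbrev coeffEmb : L →+* SkewMonoidAlgebra L M := SkewMonoidAlgebra.singleOneRingHom

/-- The subring of elements of `L # M` fixed by every automorphism in `W`. -/
def fixedSubring (W : Subgroup (RingAut (SkewMonoidAlgebra L M))) :
    Subring (SkewMonoidAlgebra L M) where
  carrier := {X | ∀ w ∈ W, w X = X}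
  mul_mem' ha hb w hw := by rw [map_mul, ha w hw, hb w hw]
  one_mem' w _ := map_one w
  add_mem' ha hb w hw := by rw [map_add, ha w hw, hb w hw]
  zero_mem' w _ := map_zero w
  neg_mem' ha w hw := by rw [map_neg, ha w hw]

/-- The subring `L ^ W` of `L`. -/
def fixedCoeff (W : Subgroup (RingAut (SkewMonoidAlgebra L M))) : Subring L :=
  (fixedSubring W).comap coeffEmb

/-- The standing assumptions on `(Λ, M, W)`: `Λ` is a noetherian integrally closed domain with
field of fractions `L`; the monoid `M` acts faithfully on `Λ` by ring automorphisms; `W` is a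
finite group acting (faithfully, being given as a group of automorphisms) on `L # M` by ring
automorphisms which preserve `Λ` and `M`. -/
structure IsSetting (Λ : Subring L) (W : Subgroup (RingAut (SkewMonoidAlgebra L M))) : Prop where
  noetherian : IsNoetherianRing Λ
  integrallyClosed : IsIntegrallyClosed Λ
  fractionRing : IsFractionRing Λ L
  map_smul : ∀ μ : M, Λ.map (MulSemiringAction.toRingHom M L μ) = Λ
  faithful : ∀ μ ν : M, (∀ a ∈ Λ, μ • a = ν • a) → μ = ν
  finite : Finite W
  preserves_coeff : ∀ w ∈ W, ∀ a ∈ Λ, ∃ b ∈ Λ, w (coeffEmb a) = coeffEmb b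
  preserves_monoid : ∀ w ∈ W, ∀ μ : M, ∃ ν : M,
    w (SkewMonoidAlgebra.of L M μ) = SkewMonoidAlgebra.of L M ν

/-- A subring `U` of `(L # M) ^ W` containing `Λ ^ W` is a principal Galois order if every element
of `U` preserves `Λ ^ W` under the natural action on `L`, and `L ^ W * U = (L # M) ^ W`
(additive span of the products). -/
structure IsPrincipalGaloisOrder (Λ : Subring L)
    (W : Subgroup (RingAut (SkewMonoidAlgebra L M)))
    (U : Subring (SkewMonoidAlgebra L M)) : Prop extends IsSetting Λ W where
  coeff_le : (Λ ⊓ fixedCoeff W).map coeffEmb ≤ U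
  le_fixed : U ≤ fixedSubring W
  preserves : ∀ X ∈ U, ∀ f ∈ Λ ⊓ fixedCoeff W, natAct X f ∈ Λ ⊓ fixedCoeff W
  span_eq : AddSubgroup.closure {Y | ∃ f ∈ fixedCoeff W, ∃ X ∈ U, Y = coeffEmb f * X} =
    (fixedSubring W).toAddSubgroup

end GaloisOrder

/-! ### The noncommutative Kleinian singularity `D(q)` -/

namespace KleinianD

/-- `ρ = 2 q(-1/2)`. -/
def rho (q : ℂ[X]) : ℂ := 2 * q.eval (-1 / 2)

/-- `p(t) = (-4 q(t) q(-t-1) + ρ²) / (1 + 2t)²`; the division is exact by `polyP_spec`. -/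
def polyP (q : ℂ[X]) : ℂ[X] :=
  (-4 * q * q.comp (-X - 1) + C (rho q ^ 2)) / (1 + 2 * X) ^ 2

/-- The even part: `p(t) = p₀(t²) + p₁(t²) t`. -/
def polyP0 (q : ℂ[X]) : ℂ[X] := contract 2 (polyP q)

/-- The odd part: `p(t) = p₀(t²) + p₁(t²) t`. -/
def polyP1 (q : ℂ[X]) : ℂ[X] := contract 2 (divX (polyP q))

theorem polyP_spec (q : ℂ[X]) :
    (1 + 2 * X) ^ 2 * polyP q = -4 * q * q.comp (-X - 1) + C (rho q ^ 2) := by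
  have hlin : (1 + 2 * X : ℂ[X]) ^ 2 = C 4 * (X - C (-1 / 2)) ^ 2 := by
    have h : (C (-1 / 2) : ℂ[X]) * 2 = -1 := by
      rw [← C_ofNat, ← C_mul]; norm_num
    have h4 : (C 4 : ℂ[X]) = 4 := rfl
    rw [h4]
    linear_combination (C (-1 / 2) * (-2 : ℂ[X]) + 4 * X + 1) * h
  unfold polyP
  set N : ℂ[X] := -4 * q * q.comp (-X - 1) + C (rho q ^ 2) with hN
  have hdvd : (X - C (-1 / 2 : ℂ)) ^ 2 ∣ N := by
    by_cases h0 : N = 0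
    · rw [h0]; exact dvd_zero _
    rw [← le_rootMultiplicity_iff h0]
    apply (one_lt_rootMultiplicity_iff_isRoot h0).2
    have e : (- (-1 / 2) - 1 : ℂ) = -1 / 2 := by norm_num
    constructor
    · simp only [hN, IsRoot, eval_add, eval_mul, eval_comp, eval_C, eval_sub, eval_neg, eval_X,
        eval_one, eval_ofNat, e, rho]
      ring
    · simp only [hN, IsRoot, derivative_add, derivative_mul, derivative_comp, derivative_C,
        derivative_sub, derivative_neg, derivative_X, derivative_one, derivative_ofNat, eval_add,
        eval_mul, eval_comp, eval_sub, eval_neg, eval_X, eval_one, eval_zero,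
        eval_ofNat, e]
      ring
  have hdvd' : (1 + 2 * X : ℂ[X]) ^ 2 ∣ N := by
    rw [hlin]
    exact (IsUnit.mul_left_dvd (isUnit_C.2 (by norm_num))).2 hdvd
  refine EuclideanDomain.mul_div_cancel' ?_ hdvd'
  rw [hlin]
  exact mul_ne_zero (by simp) (pow_ne_zero _ (X_sub_C_ne_zero _))

theorem polyP_eq (q : ℂ[X]) :
    polyP q = (polyP0 q).comp (X ^ 2) + (polyP1 q).comp (X ^ 2) * X := by
  rw [← expand_eq_comp_X_pow, ← expand_eq_comp_X_pow]
  ext n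
  unfold polyP0 polyP1
  rcases Nat.even_or_odd' n with ⟨k, rfl | rfl⟩
  · cases k with
    | zero => simp [coeff_expand, coeff_contract]
    | succ k =>
      rw [coeff_add, show 2 * (k + 1) = (2 * k + 1) + 1 by ring, coeff_mul_X]
      rw [coeff_expand two_pos, coeff_expand two_pos, if_pos (by omega), if_neg (by omega),
        coeff_contract two_ne_zero, add_zero]
      congr 1
      omega
  · rw [coeff_add, coeff_mul_X, coeff_expand two_pos, coeff_expand two_pos, if_neg (by omega),
      if_pos (by omega), coeff_contract two_ne_zero, coeff_divX, zero_add]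
    congr 1
    omega

/-- The three generators. -/
inductive Gen
  | u | v | w

/-- The defining relations of `D(q)`, where `[a, b] = a * b - b * a`:
`[u,v] = 2w + v`, `[u,w] = 2vu + w + ρ`, `[v,w] = -v² - p₁(u)`, `w² = v²u + vw + ρv + p₀(u)`. -/
inductive Rel (q : ℂ[X]) : FreeAlgebra ℂ Gen → FreeAlgebra ℂ Gen → Prop
  | uv : Rel q ⁅FreeAlgebra.ι ℂ Gen.u, FreeAlgebra.ι ℂ Gen.v⁆
      (2 * FreeAlgebra.ι ℂ Gen.w + FreeAlgebra.ι ℂ Gen.v)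
  | uw : Rel q ⁅FreeAlgebra.ι ℂ Gen.u, FreeAlgebra.ι ℂ Gen.w⁆
      (2 * FreeAlgebra.ι ℂ Gen.v * FreeAlgebra.ι ℂ Gen.u + FreeAlgebra.ι ℂ Gen.w +
        algebraMap ℂ _ (rho q))
  | vw : Rel q ⁅FreeAlgebra.ι ℂ Gen.v, FreeAlgebra.ι ℂ Gen.w⁆
      (-(FreeAlgebra.ι ℂ Gen.v) ^ 2 - aeval (FreeAlgebra.ι ℂ Gen.u) (polyP1 q))
  | ww : Rel q (FreeAlgebra.ι ℂ Gen.w ^ 2)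
      (FreeAlgebra.ι ℂ Gen.v ^ 2 * FreeAlgebra.ι ℂ Gen.u +
        FreeAlgebra.ι ℂ Gen.v * FreeAlgebra.ι ℂ Gen.w + rho q • FreeAlgebra.ι ℂ Gen.v +
        aeval (FreeAlgebra.ι ℂ Gen.u) (polyP0 q))

/-- The type `D` noncommutative Kleinian singularity `D(q)`: the unital associative `ℂ`-algebra
presented by the generators `u, v, w` and the relations `Rel q`. -/
abbrev D (q : ℂ[X]) : Type := RingQuot (Rel q)

/-- The generators of `D(q)`. -/
def gen (q : ℂ[X]) (g : Gen) : D q := RingQuot.mkAlgHom ℂ (Rel q) (FreeAlgebra.ι ℂ g)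

/-! ### The skew group algebra `ℂ(x) # ℤ` and its invariants -/

/-- The action of `ℤ` on `ℂ[x]` by shifts: `δ ^ k` sends `f(x)` to `f(x - k)`. -/
def polyShift : Multiplicative ℤ →* (ℂ[X] ≃ₐ[ℂ] ℂ[X]) where
  toFun k := algEquivAevalXAddC (-(k.toAdd : ℂ))
  map_one' := by
    apply AlgEquiv.coe_toAlgHom_injective
    ext
    simp
  map_mul' k l := by
    apply AlgEquiv.coe_toAlgHom_injective
    ext1
    simp
    ring

/-- The action of `ℤ`, written multiplicatively with generator `δ`, on `ℂ(x)`: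
`δ ^ k` sends `f(x)` to `f(x - k)`. -/
instance shiftAction : MulSemiringAction (Multiplicative ℤ) (RatFunc ℂ) :=
  MulSemiringAction.compHom (RatFunc ℂ)
    ((IsFractionRing.fieldEquivOfAlgEquivHom ℂ (RatFunc ℂ)).comp polyShift)

theorem shift_smul_def (k : Multiplicative ℤ) (f : RatFunc ℂ) :
    k • f = IsFractionRing.fieldEquivOfAlgEquivHom ℂ (RatFunc ℂ) (polyShift k) f := rfl

@[simp]
theorem shift_smul_X (k : Multiplicative ℤ) :
    k • (RatFunc.X : RatFunc ℂ) = RatFunc.X - RatFunc.C (k.toAdd : ℂ) := by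
  rw [shift_smul_def, ← RatFunc.algebraMap_X, IsFractionRing.fieldEquivOfAlgEquivHom_apply,
    IsFractionRing.fieldEquivOfAlgEquiv_algebraMap]
  simp [polyShift, sub_eq_add_neg]

instance shift_smulCommClass : SMulCommClass (Multiplicative ℤ) ℂ (RatFunc ℂ) where
  smul_comm k c f := by
    rw [Algebra.smul_def, Algebra.smul_def, shift_smul_def, map_mul, AlgEquiv.commutes]
    rfl

/-- The skew group algebra `ℂ(x) # ℤ`; `SkewMonoidAlgebra.single k f` is `f(x) δ ^ k`. -/
abbrev SkewAlg : Type := SkewMonoidAlgebra (RatFunc ℂ) (Multiplicative ℤ)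

/-- The generator `δ` of `ℤ`, as an element of the group. -/
def δ : Multiplicative ℤ := Multiplicative.ofAdd 1

/-- The embedding of `ℂ(x)` into `ℂ(x) # ℤ`. -/
def coeffHom : RatFunc ℂ →ₐ[ℂ] SkewAlg where
  __ := (SkewMonoidAlgebra.singleOneRingHom : RatFunc ℂ →+* SkewAlg)
  commutes' _ := rfl

/-- The automorphism `f(x) ↦ f(-x)` of `ℂ(x)`. -/
def negX : RatFunc ℂ ≃ₐ[ℂ] RatFunc ℂ :=
  IsFractionRing.fieldEquivOfAlgEquivHom ℂ (RatFunc ℂ) (algEquivAevalNegX (R := ℂ))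

@[simp]
theorem negX_X : negX (RatFunc.X : RatFunc ℂ) = -RatFunc.X := by
  rw [negX, ← RatFunc.algebraMap_X, IsFractionRing.fieldEquivOfAlgEquivHom_apply,
    IsFractionRing.fieldEquivOfAlgEquiv_algebraMap]
  simp

theorem algHom_ratFunc_ext {A : Type*} [Semiring A] [Nontrivial A] [Algebra ℂ A]
    {f g : RatFunc ℂ →ₐ[ℂ] A} (h : f RatFunc.X = g RatFunc.X) : f = g := by
  have key : (f.toRingHom.comp (algebraMap ℂ[X] (RatFunc ℂ))) =
      g.toRingHom.comp (algebraMap ℂ[X] (RatFunc ℂ)) := by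
    ext c
    · have e : algebraMap ℂ[X] (RatFunc ℂ) (C c) = algebraMap ℂ (RatFunc ℂ) c := by simp
      have hf := f.commutes c
      have hg := g.commutes c
      simp only [RingHom.comp_apply, e]
      exact hf.trans hg.symm
    · simpa using h
  have := IsLocalization.ringHom_ext (nonZeroDivisors ℂ[X]) key
  exact AlgHom.ext fun x => RingHom.congr_fun this x

@[simp]
theorem negX_negX (f : RatFunc ℂ) : negX (negX f) = f := by
  have : (negX : RatFunc ℂ →ₐ[ℂ] RatFunc ℂ).comp (negX : RatFunc ℂ →ₐ[ℂ] RatFunc ℂ) =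
      AlgHom.id ℂ _ := algHom_ratFunc_ext (by simp)
  exact DFunLike.congr_fun this f

theorem negX_smul (k : Multiplicative ℤ) (f : RatFunc ℂ) :
    negX (k • f) = k⁻¹ • negX f := by
  have : (negX : RatFunc ℂ →ₐ[ℂ] RatFunc ℂ).comp
        (MulSemiringAction.toAlgHom ℂ (RatFunc ℂ) k) =
      (MulSemiringAction.toAlgHom ℂ (RatFunc ℂ) k⁻¹).comp (negX : RatFunc ℂ →ₐ[ℂ] RatFunc ℂ) := by
    apply algHom_ratFunc_ext
    simp
    ring
  exact DFunLike.congr_fun this f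

/-- The endomorphism `f(x) δ ^ k ↦ f(-x) δ ^ (-k)` of `ℂ(x) # ℤ`. -/
def tauHom : SkewAlg →ₐ[ℂ] SkewAlg :=
  SkewMonoidAlgebra.liftNCAlgHom (coeffHom.comp (negX : RatFunc ℂ →ₐ[ℂ] RatFunc ℂ))
    ((SkewMonoidAlgebra.of (RatFunc ℂ) (Multiplicative ℤ)).comp
      (MulEquiv.inv (Multiplicative ℤ)).toMonoidHom) (by
    intro f k
    simp [coeffHom, SkewMonoidAlgebra.singleOneRingHom, SkewMonoidAlgebra.single_mul_single,
      negX_smul])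

@[simp]
theorem tauHom_single (k : Multiplicative ℤ) (f : RatFunc ℂ) :
    tauHom (SkewMonoidAlgebra.single k f) = SkewMonoidAlgebra.single k⁻¹ (negX f) := by
  simp [tauHom, SkewMonoidAlgebra.liftNCAlgHom, SkewMonoidAlgebra.liftNCRingHom, coeffHom,
    SkewMonoidAlgebra.singleOneRingHom, SkewMonoidAlgebra.single_mul_single]

theorem tauHom_tauHom (Y : SkewAlg) : tauHom (tauHom Y) = Y := by
  induction Y using SkewMonoidAlgebra.induction_on with
  | zero => simp
  | single k f => simp
  | add a b ha hb => rw [map_add, map_add, ha, hb]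

/-- The nontrivial element `τ` of `S₂`, acting on `ℂ(x) # ℤ` by the `ℂ`-algebra automorphism which
negates `x` and inverts `δ`. -/
def tau : SkewAlg ≃ₐ[ℂ] SkewAlg :=
  AlgEquiv.ofAlgHom tauHom tauHom (AlgHom.ext tauHom_tauHom) (AlgHom.ext tauHom_tauHom)

/-- The group `S₂ = ⟨τ⟩`, as a group of ring automorphisms of `ℂ(x) # ℤ`. -/
def S2 : Subgroup (RingAut SkewAlg) := Subgroup.zpowers (tau : SkewAlg ≃+* SkewAlg)

/-- The invariant subalgebra `(ℂ(x) # ℤ) ^ S₂`. -/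
def invariants : Subalgebra ℂ SkewAlg := AlgHom.equalizer (tau : SkewAlg →ₐ[ℂ] SkewAlg) (.id ℂ _)

/-- `ℂ[x²]`, inside `ℂ(x)`. -/
def evenPoly : Subalgebra ℂ (RatFunc ℂ) := Algebra.adjoin ℂ {RatFunc.X ^ 2}

/-- `ℂ(x²)`, inside `ℂ(x) # ℤ`. -/
def evenRat : Subalgebra ℂ SkewAlg :=
  (IntermediateField.adjoin ℂ {(RatFunc.X ^ 2 : RatFunc ℂ)}).toSubalgebra.map coeffHom

/-- The subalgebra of `ℂ(x) # ℤ` of all elements which preserve `ℂ[x²]` under the natural action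
on `ℂ(x)`. -/
def preserving : Subalgebra ℂ SkewAlg where
  carrier := {Y | ∀ f ∈ evenPoly, GaloisOrder.natAct Y f ∈ evenPoly}
  mul_mem' ha hb f hf := by
    rw [map_mul]
    exact ha _ (hb f hf)
  add_mem' ha hb f hf := by
    rw [map_add]
    exact add_mem (ha f hf) (hb f hf)
  algebraMap_mem' c f hf := by
    have : GaloisOrder.natAct (algebraMap ℂ SkewAlg c) f = algebraMap ℂ (RatFunc ℂ) c * f := by
      simp [SkewMonoidAlgebra.coe_algebraMap]
    rw [this]
    exact mul_mem (evenPoly.algebraMap_mem c) hf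

/-- `Λ = ℂ[x]`, inside `ℂ(x)`. -/
def polySubring : Subring (RatFunc ℂ) := (algebraMap ℂ[X] (RatFunc ℂ)).range

end KleinianD

end

open KleinianD SkewMonoidAlgebra

open Polynomial

open KleinianD SkewMonoidAlgebra

noncomputable section

namespace KleinianD

/-! ### Even polynomials and even rational functions -/

/-! The displayed formulas for `-v-w` and `-v/2-w` determine the images of `v` and `w`. Both have
the form `a δ⁻¹ + c + τ(a) δ`, with `a = q(x)/(x(2x+1))`, `c = 2ρ/(1-4x²)` for `v`, and with
`-a(x+1)`, `-c/2` in place of `a`, `c` for `w`. The relations are checked coefficient by coefficient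
in `δ⁻², …, δ²`. The polynomial `p` enters only through the `δ⁰` coefficients, because `a·δ⁻¹(τ(a))`
is, up to elementary factors and a `ρ²` term, `p(x)`.

The rest is a leading term argument in the most negative power of `δ`. The relations let every
element of `D(q)` be written as a combination of `vʲP(u)` and `vᵏwQ(u)` (`exists_mem_pbw`). The
image of `vⁿ` leads with a nonzero `ℓₙ δ⁻ⁿ`. Since `-a(x+1) = a·δ⁻¹(-x)`, the image of `vⁿ⁻¹w` leads
with `ℓₙ·δ⁻ⁿ(-x)`. Hence `vⁿP(u) + vⁿ⁻¹wQ(u)` leads with `ℓₙ·δ⁻ⁿ(P(x²) - xQ(x²))`. Separating even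
and odd parts, this vanishes only for `P = Q = 0`, which gives injectivity.

The same computation with coefficients in `ℂ(x²)` reaches every leading coefficient, because `ℂ(x) =
ℂ(x²) ⊕ xℂ(x²)`. An invariant element is determined by its nonpositive powers of `δ`, so descending
on the leading degree gives (ii) (`eq_of_forall_hasLead`).

For (iii), an invariant operator sends even functions to even functions, so only polynomiality is at
stake. It is checked on `-v-w` and `-v/2-w`, where the possible poles cancel visibly. -/

theorem comp_neg_X_coeff (P : ℂ[X]) (n : ℕ) : (P.comp (-X)).coeff n = (-1) ^ n * P.coeff n := by
  have h : (-X : ℂ[X]) = C (-1) * X := by simp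
  rw [h, comp_C_mul_X_coeff, mul_comm]

theorem exists_eq_expand_of_comp_neg_X {P : ℂ[X]} (h : P.comp (-X) = P) :
    ∃ g : ℂ[X], P = expand ℂ 2 g := by
  refine ⟨contract 2 P, ?_⟩
  ext n
  rw [coeff_expand two_pos]
  split_ifs with hn
  · rw [coeff_contract two_ne_zero, Nat.div_mul_cancel hn]
  · have h1 := congrArg (fun R => R.coeff n) h
    simp only [comp_neg_X_coeff] at h1
    rw [Odd.neg_one_pow (Nat.not_even_iff_odd.1 (fun h2 => hn h2.two_dvd))] at h1
    linear_combination (-1 / 2 : ℂ) * h1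

theorem algebraMap_eq_aeval (P : ℂ[X]) :
    algebraMap ℂ[X] (RatFunc ℂ) P = aeval RatFunc.X P := by
  rw [← RatFunc.algebraMap_X, aeval_algebraMap_apply, aeval_X_left_apply]

theorem negX_aeval (f : RatFunc ℂ) (P : ℂ[X]) : negX (aeval f P) = aeval (negX f) P :=
  (aeval_algHom_apply (negX : RatFunc ℂ →ₐ[ℂ] RatFunc ℂ) f P).symm

theorem smul_aeval (k : Multiplicative ℤ) (f : RatFunc ℂ) (P : ℂ[X]) :
    k • aeval f P = aeval (k • f) P :=
  (aeval_algHom_apply (MulSemiringAction.toAlgHom ℂ (RatFunc ℂ) k) f P).symm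

@[simp]
theorem smul_C (k : Multiplicative ℤ) (c : ℂ) : k • (RatFunc.C c : RatFunc ℂ) = RatFunc.C c := by
  rw [← RatFunc.algebraMap_eq_C]
  exact (MulSemiringAction.toAlgHom ℂ (RatFunc ℂ) k).commutes c

theorem smul_div_ratFunc (k : Multiplicative ℤ) (f g : RatFunc ℂ) :
    k • (f / g) = (k • f) / (k • g) :=
  map_div₀ (MulSemiringAction.toRingHom _ (RatFunc ℂ) k) f g

theorem mem_evenPoly_iff {f : RatFunc ℂ} :
    f ∈ evenPoly ↔ ∃ g : ℂ[X], f = aeval (RatFunc.X ^ 2) g := by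
  rw [evenPoly, Algebra.adjoin_singleton_eq_range_aeval]
  exact ⟨fun ⟨g, hg⟩ => ⟨g, hg.symm⟩, fun ⟨g, hg⟩ => ⟨g, hg.symm⟩⟩

theorem negX_aeval_X_sq (g : ℂ[X]) :
    negX (aeval (RatFunc.X ^ 2 : RatFunc ℂ) g) = aeval (RatFunc.X ^ 2 : RatFunc ℂ) g := by
  rw [negX_aeval]
  simp

theorem aeval_mem_evenPoly {P : ℂ[X]}
    (h : negX (aeval (RatFunc.X : RatFunc ℂ) P) = aeval (RatFunc.X : RatFunc ℂ) P) :
    aeval (RatFunc.X : RatFunc ℂ) P ∈ evenPoly := by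
  have h1 : P.comp (-X) = P := by
    apply IsFractionRing.injective ℂ[X] (RatFunc ℂ)
    rw [algebraMap_eq_aeval, algebraMap_eq_aeval, aeval_comp, ← h, negX_aeval, negX_X]
    simp
  obtain ⟨g, rfl⟩ := exists_eq_expand_of_comp_neg_X h1
  exact mem_evenPoly_iff.2 ⟨g, by rw [expand_aeval]⟩

theorem mem_evenPoly_iff_negX {f : RatFunc ℂ} :
    f ∈ evenPoly ↔ f ∈ polySubring ∧ negX f = f := by
  constructor
  · intro hf
    obtain ⟨g, rfl⟩ := mem_evenPoly_iff.1 hf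
    refine ⟨⟨expand ℂ 2 g, ?_⟩, negX_aeval_X_sq g⟩
    rw [algebraMap_eq_aeval, expand_aeval]
  · rintro ⟨⟨P, rfl⟩, h⟩
    rw [algebraMap_eq_aeval] at h ⊢
    exact aeval_mem_evenPoly h

theorem ratFunc_X_ne_zero : (RatFunc.X : RatFunc ℂ) ≠ 0 := RatFunc.X_ne_zero

theorem mem_adjoin_X_sq_iff {f : RatFunc ℂ} :
    f ∈ IntermediateField.adjoin ℂ {(RatFunc.X ^ 2 : RatFunc ℂ)} ↔ negX f = f := by
  constructor
  · intro hf
    induction hf using IntermediateField.adjoin_induction with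
    | mem x hx => rw [Set.mem_singleton_iff.1 hx]; simp
    | algebraMap c => exact negX.commutes c
    | add x y _ _ hx hy => rw [map_add, hx, hy]
    | inv x _ hx => rw [map_inv₀, hx]
    | mul x y _ _ hx hy => rw [map_mul, hx, hy]
  · intro hf
    have key : ∀ g ∈ evenPoly, g ∈ IntermediateField.adjoin ℂ {(RatFunc.X ^ 2 : RatFunc ℂ)} :=
      fun g hg => IntermediateField.algebra_adjoin_le_adjoin ℂ _ hg
    obtain ⟨P, Q, hQ, rfl⟩ := IsFractionRing.div_surjective (A := ℂ[X]) f
    have hQ0 : algebraMap ℂ[X] (RatFunc ℂ) Q ≠ 0 :=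
      IsFractionRing.to_map_ne_zero_of_mem_nonZeroDivisors hQ
    have hN0 : negX (algebraMap ℂ[X] (RatFunc ℂ) Q) ≠ 0 := by simpa using hQ0
    have hneg : ∀ R : ℂ[X], negX (algebraMap ℂ[X] (RatFunc ℂ) R) =
        algebraMap ℂ[X] (RatFunc ℂ) (R.comp (-X)) := by
      intro R
      rw [algebraMap_eq_aeval, algebraMap_eq_aeval, negX_aeval, aeval_comp]
      simp
    set a := algebraMap ℂ[X] (RatFunc ℂ) P
    set b := algebraMap ℂ[X] (RatFunc ℂ) Q
    have hab : negX a * b = a * negX b := by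
      rw [map_div₀] at hf
      field_simp at hf
      linear_combination hf
    -- Multiplying by the reflected denominator makes the denominator a norm, hence even; the
    -- numerator is then even because the quotient is.
    have e : a / b = (a * negX b) / (b * negX b) := by field_simp
    rw [e]
    refine div_mem (key _ (mem_evenPoly_iff_negX.2 ⟨?_, ?_⟩))
      (key _ (mem_evenPoly_iff_negX.2 ⟨?_, ?_⟩))
    · exact mul_mem ⟨P, rfl⟩ ⟨_, (hneg Q).symm⟩
    · rw [map_mul, negX_negX, hab]
    · exact mul_mem ⟨Q, rfl⟩ ⟨_, (hneg Q).symm⟩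
    · rw [map_mul, negX_negX, mul_comm]

/-- `1, x` span `ℂ(x)` over `ℂ(x²)`; this supplies the coefficients of `vⁿ⁺¹` and `vⁿw` when a
leading coefficient is prescribed. -/
theorem exists_even_add_X_mul_even (h : RatFunc ℂ) :
    ∃ h₀ h₁ : RatFunc ℂ, negX h₀ = h₀ ∧ negX h₁ = h₁ ∧ h = h₀ + RatFunc.X * h₁ := by
  have hX := ratFunc_X_ne_zero
  refine ⟨(h + negX h) / 2, (h - negX h) / (2 * RatFunc.X), ?_, ?_, ?_⟩
  · simp only [map_div₀, map_add, negX_negX, map_ofNat, add_comm]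
  · simp only [map_div₀, map_sub, map_mul, negX_negX, map_ofNat, negX_X]
    field_simp
    ring
  · field_simp
    ring

/-- Reflection changes the sign of the second term only, so the even and odd parts vanish
separately. Injectivity rests on this independence. -/
theorem eq_zero_of_even_sub_X_mul_even {P Q : ℂ[X]}
    (h : aeval (RatFunc.X ^ 2 : RatFunc ℂ) P - RatFunc.X * aeval (RatFunc.X ^ 2 : RatFunc ℂ) Q = 0) :
    P = 0 ∧ Q = 0 := by
  have h' := congrArg negX h
  simp only [map_sub, map_mul, negX_aeval_X_sq, negX_X, map_zero] at h'
  have hinj : ∀ R : ℂ[X], aeval (RatFunc.X ^ 2 : RatFunc ℂ) R = 0 → R = 0 := by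
    intro R hR
    rw [← expand_aeval, ← algebraMap_eq_aeval] at hR
    have := (map_eq_zero_iff _ (IsFractionRing.injective ℂ[X] (RatFunc ℂ))).1 hR
    exact (expand_eq_zero two_pos).1 this
  constructor
  · apply hinj
    linear_combination (h + h') / 2
  · apply hinj
    have : RatFunc.X * aeval (RatFunc.X ^ 2 : RatFunc ℂ) Q = 0 := by
      linear_combination (h' - h) / 2
    exact (mul_eq_zero.1 this).resolve_left ratFunc_X_ne_zero

theorem X_add_C_ne_zero (c : ℂ) : (RatFunc.X + RatFunc.C c : RatFunc ℂ) ≠ 0 := by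
  have : (RatFunc.X + RatFunc.C c : RatFunc ℂ) = algebraMap ℂ[X] (RatFunc ℂ) (X + C c) := by simp
  rw [this]
  exact (map_ne_zero_iff _ (IsFractionRing.injective ℂ[X] (RatFunc ℂ))).2 (Polynomial.X_add_C_ne_zero c)

theorem linear_ne_zero {f : RatFunc ℂ} (b c : ℂ) (hb : b ≠ 0)
    (h : f = RatFunc.C b * (RatFunc.X + RatFunc.C c)) : f ≠ 0 := by
  rw [h]
  exact mul_ne_zero (by simpa using hb) (X_add_C_ne_zero c)

/-! ### Elements of `ℂ(x) # ℤ` supported near the identity -/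

/-- The element `a δ⁻¹ + c + b δ`. -/
def tri (a c b : RatFunc ℂ) : SkewAlg := single δ⁻¹ a + single 1 c + single δ b

/-- The element `a δ⁻² + b δ⁻¹ + c + d δ + e δ²`. -/
def quint (a b c d e : RatFunc ℂ) : SkewAlg :=
  single (δ⁻¹ * δ⁻¹) a + single δ⁻¹ b + single 1 c + single δ d + single (δ * δ) e

/-- The defining relations are at most quadratic in `v, w`, and `u` has no `δ`, so five coefficients
suffice to test all of them. -/
theorem tri_mul_tri (a c b a' c' b' : RatFunc ℂ) :
    tri a c b * tri a' c' b' =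
      quint (a * δ⁻¹ • a') (a * δ⁻¹ • c' + c * a') (a * δ⁻¹ • b' + c * c' + b * δ • a')
        (c * b' + b * δ • c') (b * δ • b') := by
  simp only [tri, quint, add_mul, mul_add, single_mul_single, single_add, one_smul, mul_one,
    one_mul, mul_inv_cancel, inv_mul_cancel]
  abel

theorem tri_eq_quint (a c b : RatFunc ℂ) : tri a c b = quint 0 a c b 0 := by
  simp [tri, quint]

theorem single_one_eq_tri (c : RatFunc ℂ) : (single 1 c : SkewAlg) = tri 0 c 0 := by
  simp [tri]

theorem tri_add (a c b a' c' b' : RatFunc ℂ) :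
    tri a c b + tri a' c' b' = tri (a + a') (c + c') (b + b') := by
  simp only [tri, single_add]
  abel

theorem tri_neg (a c b : RatFunc ℂ) : -tri a c b = tri (-a) (-c) (-b) := by
  simp only [tri, single_neg]
  abel

theorem tri_sub (a c b a' c' b' : RatFunc ℂ) :
    tri a c b - tri a' c' b' = tri (a - a') (c - c') (b - b') := by
  rw [sub_eq_add_neg, tri_neg, tri_add]
  simp only [sub_eq_add_neg]

theorem tri_smul (r : ℂ) (a c b : RatFunc ℂ) :
    r • tri a c b = tri (RatFunc.C r * a) (RatFunc.C r * c) (RatFunc.C r * b) := by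
  simp only [tri, smul_add, smul_single, RatFunc.smul_eq_C_mul]

theorem quint_add (a b c d e a' b' c' d' e' : RatFunc ℂ) :
    quint a b c d e + quint a' b' c' d' e' =
      quint (a + a') (b + b') (c + c') (d + d') (e + e') := by
  simp only [quint, single_add]
  abel

theorem quint_neg (a b c d e : RatFunc ℂ) :
    -quint a b c d e = quint (-a) (-b) (-c) (-d) (-e) := by
  simp only [quint, single_neg]
  abel

theorem quint_sub (a b c d e a' b' c' d' e' : RatFunc ℂ) :
    quint a b c d e - quint a' b' c' d' e' =
      quint (a - a') (b - b') (c - c') (d - d') (e - e') := by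
  rw [sub_eq_add_neg, quint_neg, quint_add]
  simp only [sub_eq_add_neg]

theorem tauHom_tri (a c b : RatFunc ℂ) :
    tauHom (tri a c b) = tri (negX b) (negX c) (negX a) := by
  simp only [tri, map_add, tauHom_single, inv_inv, inv_one]
  abel

theorem natAct_tri (a c b f : RatFunc ℂ) :
    GaloisOrder.natAct (tri a c b) f = a * δ⁻¹ • f + c * f + b * δ • f := by
  have h : GaloisOrder.natAct (tri a c b) f = GaloisOrder.natAct (single δ⁻¹ a) f + GaloisOrder.natAct (single (1 : Multiplicative ℤ) c) f +
        GaloisOrder.natAct (single δ b) f := by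
    rw [tri, map_add, map_add]
    rfl
  rw [h]
  simp

/-! ### Leading terms -/

/-- `Y` has the form `c δ⁻ⁿ + (terms with larger powers of δ)`. -/
def HasLead (n : ℕ) (c : RatFunc ℂ) (Y : SkewAlg) : Prop :=
  Y.coeff (δ ^ n)⁻¹ = c ∧ ∀ m : ℕ, n < m → Y.coeff (δ ^ m)⁻¹ = 0

theorem δ_eq_one_iff (k : ℤ) : δ ^ k = 1 ↔ k = 0 := by
  rw [δ, ← ofAdd_zsmul, ofAdd_eq_one]
  simp

theorem δ_zpow_inj {k l : ℤ} : δ ^ k = δ ^ l ↔ k = l := by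
  rw [← mul_inv_eq_one, ← zpow_sub, δ_eq_one_iff, sub_eq_zero]

theorem eq_δ_zpow (g : Multiplicative ℤ) : ∃ k : ℤ, g = δ ^ k :=
  ⟨g.toAdd, by rw [δ, ← ofAdd_zsmul]; simp⟩

theorem HasLead.add {n : ℕ} {c d : RatFunc ℂ} {Y Z : SkewAlg} (hY : HasLead n c Y)
    (hZ : HasLead n d Z) : HasLead n (c + d) (Y + Z) :=
  ⟨by simp [hY.1, hZ.1], fun m hm => by simp [hY.2 m hm, hZ.2 m hm]⟩

/-- Leading coefficients may be zero, so lower terms can be added in degree `n + 1` without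
affecting the lead. -/
theorem HasLead.succ {n : ℕ} {c : RatFunc ℂ} {Y : SkewAlg} (hY : HasLead n c Y) :
    HasLead (n + 1) 0 Y :=
  ⟨hY.2 _ (by omega), fun m hm => hY.2 m (by omega)⟩

theorem HasLead.coeff_mul {n : ℕ} {c : RatFunc ℂ} {Y : SkewAlg} (hY : HasLead n c Y)
    (f : RatFunc ℂ) : HasLead n (f * c) (single 1 f * Y) := by
  refine ⟨?_, fun m hm => ?_⟩
  · rw [coeff_single_mul, inv_one, one_mul, one_smul, hY.1]
  · rw [coeff_single_mul, inv_one, one_mul, one_smul, hY.2 m hm, mul_zero]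

theorem HasLead.mul_coeff {n : ℕ} {c : RatFunc ℂ} {Y : SkewAlg} (hY : HasLead n c Y)
    (f : RatFunc ℂ) : HasLead n (c * (δ ^ n)⁻¹ • f) (Y * single 1 f) := by
  refine ⟨?_, fun m hm => ?_⟩
  · rw [coeff_mul_single_one, hY.1]
  · rw [coeff_mul_single_one, hY.2 m hm, zero_mul]

/-- Only the `δ⁻¹` term of the left factor can lower the smallest power of `δ`. -/
theorem HasLead.tri_mul {n : ℕ} {d : RatFunc ℂ} {Y : SkewAlg} (hY : HasLead n d Y)
    (a c b : RatFunc ℂ) : HasLead (n + 1) (a * δ⁻¹ • d) (tri a c b * Y) := by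
  have e1 : ∀ m : ℕ, (δ⁻¹)⁻¹ * (δ ^ (m + 1))⁻¹ = (δ ^ m)⁻¹ := fun m => by
    rw [pow_succ]; group
  have e2 : ∀ m : ℕ, δ⁻¹ * (δ ^ m)⁻¹ = (δ ^ (m + 1))⁻¹ := fun m => by
    rw [pow_succ]; group
  have key : ∀ m : ℕ, (tri a c b * Y).coeff (δ ^ (m + 1))⁻¹ =
      a * δ⁻¹ • Y.coeff (δ ^ m)⁻¹ + c * Y.coeff (δ ^ (m + 1))⁻¹ +
        b * δ • Y.coeff (δ ^ (m + 2))⁻¹ := by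
    intro m
    simp only [tri, add_mul, SkewMonoidAlgebra.coeff_add, Finsupp.add_apply, coeff_single_mul, e1, e2, inv_one,
      one_mul, one_smul]
  refine ⟨?_, fun m hm => ?_⟩
  · rw [key, hY.1, hY.2 _ (by omega), hY.2 _ (by omega)]
    simp
  · obtain ⟨m, rfl⟩ : ∃ k, m = k + 1 := ⟨m - 1, by omega⟩
    rw [key, hY.2 _ (by omega), hY.2 _ (by omega), hY.2 _ (by omega)]
    simp

theorem hasLead_one : HasLead 0 1 (1 : SkewAlg) := by
  refine ⟨by simp, fun m hm => ?_⟩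
  rw [one_def, coeff_single_apply, if_neg]
  intro h
  have := (δ_zpow_inj (k := -m) (l := 0)).1 (by simpa using h.symm)
  omega

/-- The coefficients of an invariant element are exchanged by `τ`. -/
theorem coeff_inv_of_mem_invariants {Y : SkewAlg} (hY : Y ∈ invariants)
    (k : Multiplicative ℤ) : Y.coeff k⁻¹ = negX (Y.coeff k) := by
  have h : ∀ Z : SkewAlg, (tauHom Z).coeff k⁻¹ = negX (Z.coeff k) := by
    intro Z
    induction Z using SkewMonoidAlgebra.induction_on with
    | zero => simp
    | single g f =>
      classical
      simp only [tauHom_single, coeff_single_apply, inv_inj]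
      split_ifs <;> simp
    | add a b ha hb => simp [ha, hb]
  have hτ : tauHom Y = Y := hY
  rw [← h Y, hτ]

theorem mem_invariants_iff {Y : SkewAlg} : Y ∈ invariants ↔ tauHom Y = Y := Iff.rfl

/-- An invariant element with leading term at `δ⁰` is an even coefficient. -/
theorem eq_single_of_hasLead_zero {Y : SkewAlg} (hY : Y ∈ invariants) {c : RatFunc ℂ}
    (h : HasLead 0 c Y) : negX c = c ∧ Y = single 1 c := by
  have h1 : Y.coeff 1 = c := by simpa using h.1
  refine ⟨?_, ?_⟩
  · have := coeff_inv_of_mem_invariants hY 1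
    rw [inv_one, h1] at this
    exact this.symm
  · ext g
    classical
    rw [coeff_single_apply]
    split_ifs with hg
    · rw [← hg, h1]
    · obtain ⟨k, rfl⟩ := eq_δ_zpow g
      obtain ⟨m, rfl | rfl⟩ := k.eq_nat_or_neg
      · have := coeff_inv_of_mem_invariants hY (δ ^ m)
        have hm : 0 < m := by
          rcases Nat.eq_zero_or_pos m with rfl | hm
          · simp at hg
          · exact hm
        rw [h.2 m hm] at this
        rw [zpow_natCast]
        simpa using this.symm
      · have hm : 0 < m := by
          rcases Nat.eq_zero_or_pos m with rfl | hm
          · simp at hg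
          · exact hm
        rw [zpow_neg, zpow_natCast, h.2 m hm]

/-- Since the lead may be zero, any bound on the negative support serves as degree. -/
theorem exists_hasLead (Y : SkewAlg) : ∃ n c, HasLead n c Y := by
  induction Y using SkewMonoidAlgebra.induction_on with
  | zero => exact ⟨0, 0, by simp, by simp⟩
  | single g f =>
    obtain ⟨k, rfl⟩ := eq_δ_zpow g
    refine ⟨k.natAbs, _, rfl, fun m hm => ?_⟩
    classical
    rw [coeff_single_apply, if_neg]
    intro h
    rw [← zpow_natCast, ← zpow_neg, δ_zpow_inj] at h
    omega
  | add a b ha hb =>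
    obtain ⟨n, c, h⟩ := ha
    obtain ⟨n', c', h'⟩ := hb
    exact ⟨max n n', _, rfl, fun m hm => by
      simp [h.2 m (by omega), h'.2 m (by omega)]⟩

/-- A submodule of invariants which realises every leading coefficient is everything. -/
theorem eq_of_forall_hasLead {M : Submodule ℂ SkewAlg}
    (hM : M ≤ Subalgebra.toSubmodule invariants)
    (h0 : ∀ f, negX f = f → single 1 f ∈ M)
    (h1 : ∀ (n : ℕ) (f : RatFunc ℂ), ∃ Y ∈ M, HasLead (n + 1) f Y) :
    M = Subalgebra.toSubmodule invariants := by
  refine le_antisymm hM ?_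
  have key : ∀ (n : ℕ) (c : RatFunc ℂ) (Y : SkewAlg), Y ∈ invariants → HasLead n c Y → Y ∈ M := by
    intro n
    induction n with
    | zero =>
      intro c Y hY h
      obtain ⟨hc, rfl⟩ := eq_single_of_hasLead_zero hY h
      exact h0 c hc
    | succ n ih =>
      intro c Y hY h
      obtain ⟨Z, hZ, hZl⟩ := h1 n c
      have : Y - Z ∈ M := by
        -- `Y` and `Z` agree at `δ⁻ⁿ⁻¹`, so the difference has degree at most `n`.
        refine ih _ _ (sub_mem hY (hM hZ)) ⟨rfl, fun m hm => ?_⟩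
        rcases Nat.lt_or_ge (n + 1) m with hm' | hm'
        · simp [h.2 m hm', hZl.2 m hm']
        · obtain rfl : m = n + 1 := by omega
          rw [SkewMonoidAlgebra.coeff_sub, Finsupp.sub_apply, h.1, hZl.1, sub_self]
      simpa using add_mem this hZ
  intro Y hY
  obtain ⟨n, c, h⟩ := exists_hasLead Y
  exact key n c Y hY h

/-! ### The images of the generators -/

/-- The coefficient of `δ⁻¹` in the image of `v`. -/
def coeffV (q : ℂ[X]) : RatFunc ℂ := aeval RatFunc.X q / (RatFunc.X * (2 * RatFunc.X + 1))

/-- The coefficient of `1` in the image of `v`. -/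
def coeffV0 (q : ℂ[X]) : RatFunc ℂ := 2 * RatFunc.C (rho q) / (1 - 4 * RatFunc.X ^ 2)

/-- The image of `v` in `ℂ(x) # ℤ`. -/
def imV (q : ℂ[X]) : SkewAlg := tri (coeffV q) (coeffV0 q) (negX (coeffV q))

/-- The image of `w` in `ℂ(x) # ℤ`. -/
def imW (q : ℂ[X]) : SkewAlg :=
  tri (-coeffV q * (RatFunc.X + 1)) (-coeffV0 q / 2) (-negX (coeffV q) * (1 - RatFunc.X))

/-- The image of `u` in `ℂ(x) # ℤ`. -/
def imU : SkewAlg := tri 0 (RatFunc.X ^ 2) 0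

theorem δ_smul_X : δ • (RatFunc.X : RatFunc ℂ) = RatFunc.X - 1 := by
  rw [shift_smul_X]; simp [δ]

theorem δ_inv_smul_X : δ⁻¹ • (RatFunc.X : RatFunc ℂ) = RatFunc.X + 1 := by
  rw [shift_smul_X]; simp [δ]

theorem smul_ofNat_ratFunc (k : Multiplicative ℤ) (n : ℕ) [n.AtLeastTwo] :
    k • (ofNat(n) : RatFunc ℂ) = ofNat(n) :=
  map_ofNat (MulSemiringAction.toRingHom _ (RatFunc ℂ) k) n

theorem negX_C (c : ℂ) : negX (RatFunc.C c) = RatFunc.C c := by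
  rw [← RatFunc.algebraMap_eq_C]
  exact negX.commutes c

/-! ### Denominators, shifts of coefficients, and `p` in terms of the coefficients of `v` -/

theorem X_linear_ne_zero :
    (1 + 2 * RatFunc.X : RatFunc ℂ) ≠ 0 ∧ (1 - 2 * RatFunc.X : RatFunc ℂ) ≠ 0 ∧
    (3 + 2 * RatFunc.X : RatFunc ℂ) ≠ 0 ∧ (3 - 2 * RatFunc.X : RatFunc ℂ) ≠ 0 ∧
    (RatFunc.X + 1 : RatFunc ℂ) ≠ 0 ∧ (1 - RatFunc.X : RatFunc ℂ) ≠ 0 := by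
  have e3 : (RatFunc.C 3 : RatFunc ℂ) = 3 := map_ofNat _ 3
  have e2 : (RatFunc.C 2 : RatFunc ℂ) = 2 := map_ofNat _ 2
  refine ⟨linear_ne_zero 2 (1 / 2) ?_ ?_, linear_ne_zero (-2) (-1 / 2) ?_ ?_,
    linear_ne_zero 2 (3 / 2) ?_ ?_, linear_ne_zero (-2) (-3 / 2) ?_ ?_,
    linear_ne_zero 1 1 ?_ ?_, linear_ne_zero (-1) (-1) ?_ ?_⟩ <;>
  first
  | norm_num
    done
  | simp only [map_div₀, map_neg, map_one, e2, e3]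
    field_simp
    ring

theorem one_sub_four_X_sq :
    (1 - 4 * RatFunc.X ^ 2 : RatFunc ℂ) = (1 + 2 * RatFunc.X) * (1 - 2 * RatFunc.X) := by ring

theorem negX_coeffV0 (q : ℂ[X]) : negX (coeffV0 q) = coeffV0 q := by
  simp only [coeffV0, negX_C, negX_X, map_div₀, map_mul, map_sub, map_pow, map_one,
    map_ofNat, neg_sq]

theorem δ_smul_coeffV0 (q : ℂ[X]) : δ • coeffV0 q =
    -2 * RatFunc.C (rho q) / ((1 - 2 * RatFunc.X) * (3 - 2 * RatFunc.X)) := by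
  obtain ⟨h1, h2, h3, h4, -, -⟩ := X_linear_ne_zero
  rw [coeffV0, one_sub_four_X_sq]
  simp only [smul_div_ratFunc, smul_mul', smul_add, smul_sub, smul_ofNat_ratFunc, smul_C,
    δ_smul_X, smul_one]
  have e1 : (1 + 2 * (RatFunc.X - 1) : RatFunc ℂ) = -(1 - 2 * RatFunc.X) := by ring
  have e2 : (1 - 2 * (RatFunc.X - 1) : RatFunc ℂ) = 3 - 2 * RatFunc.X := by ring
  rw [e1, e2]
  field_simp

theorem δ_inv_smul_coeffV0 (q : ℂ[X]) : δ⁻¹ • coeffV0 q =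
    -2 * RatFunc.C (rho q) / ((1 + 2 * RatFunc.X) * (3 + 2 * RatFunc.X)) := by
  have h := congrArg negX (δ_smul_coeffV0 q)
  rw [negX_smul, negX_coeffV0] at h
  rw [h]
  simp only [negX_C, negX_X, map_div₀, map_mul, map_sub, map_neg, map_one, map_ofNat, mul_neg,
    sub_neg_eq_add]

/-- The shift sends `τ(a)` to `q(-x-1)/((x+1)(1+2x))`, so its product with `a` is the numerator term
`q(x)q(-x-1)` of `p` over `x(x+1)(1+2x)²`. -/
theorem aeval_polyP (q : ℂ[X]) : aeval RatFunc.X (polyP q) =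
    -4 * RatFunc.X * (RatFunc.X + 1) * (coeffV q * δ⁻¹ • negX (coeffV q)) +
      RatFunc.C (rho q) ^ 2 / (1 + 2 * RatFunc.X) ^ 2 := by
  obtain ⟨h1, h2, h3, h4, h5, h6⟩ := X_linear_ne_zero
  have hX := ratFunc_X_ne_zero
  have h := congrArg (aeval (RatFunc.X : RatFunc ℂ)) (polyP_spec q)
  simp only [map_mul, map_add, map_pow, map_one, map_ofNat, map_neg, aeval_X, aeval_comp, aeval_C,
    map_sub, RatFunc.algebraMap_eq_C] at h
  have e : δ⁻¹ • negX (coeffV q) =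
      aeval (-RatFunc.X - 1 : RatFunc ℂ) q / ((RatFunc.X + 1) * (1 + 2 * RatFunc.X)) := by
    simp only [coeffV, map_div₀, map_mul, negX_aeval, negX_X, map_add, map_one, map_ofNat,
      smul_div_ratFunc, smul_aeval, smul_mul', smul_add, smul_neg, δ_inv_smul_X, smul_one,
      smul_ofNat_ratFunc]
    congr 1
    · congr 1
      ring_nf
    · ring
  rw [e, coeffV, show (2 * RatFunc.X + 1 : RatFunc ℂ) = 1 + 2 * RatFunc.X by ring]
  have h' : aeval RatFunc.X (polyP q) = (-4 * aeval (RatFunc.X : RatFunc ℂ) q *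
      aeval (-RatFunc.X - 1 : RatFunc ℂ) q + RatFunc.C (rho q) ^ 2) / (1 + 2 * RatFunc.X) ^ 2 := by
    rw [eq_div_iff (pow_ne_zero 2 h1), ← h, mul_comm]
  rw [h']
  field_simp

theorem aeval_neg_polyP (q : ℂ[X]) : aeval (-RatFunc.X) (polyP q) =
    4 * RatFunc.X * (1 - RatFunc.X) * (negX (coeffV q) * δ • coeffV q) +
      RatFunc.C (rho q) ^ 2 / (1 - 2 * RatFunc.X) ^ 2 := by
  have h := congrArg negX (aeval_polyP q)
  simp only [negX_aeval, negX_X, map_add, map_mul, negX_smul, negX_negX, inv_inv, map_div₀,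
    map_pow, negX_C, map_neg, map_one, map_ofNat] at h
  rw [h]
  ring

theorem aeval_polyP0_polyP1 (q : ℂ[X]) (f : RatFunc ℂ) :
    aeval f (polyP q) = aeval (f ^ 2) (polyP0 q) + aeval (f ^ 2) (polyP1 q) * f := by
  conv_lhs => rw [polyP_eq q]
  simp [aeval_comp]

theorem aeval_polyP0 (q : ℂ[X]) : aeval (RatFunc.X ^ 2 : RatFunc ℂ) (polyP0 q) =
    (aeval RatFunc.X (polyP q) + aeval (-RatFunc.X) (polyP q)) / 2 := by
  rw [aeval_polyP0_polyP1, aeval_polyP0_polyP1, neg_sq]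
  ring

theorem aeval_polyP1 (q : ℂ[X]) : aeval (RatFunc.X ^ 2 : RatFunc ℂ) (polyP1 q) =
    (aeval RatFunc.X (polyP q) - aeval (-RatFunc.X) (polyP q)) / (2 * RatFunc.X) := by
  have hX := ratFunc_X_ne_zero
  rw [aeval_polyP0_polyP1, aeval_polyP0_polyP1, neg_sq]
  field_simp
  ring

theorem aeval_imU (P : ℂ[X]) : aeval imU P = single 1 (aeval (RatFunc.X ^ 2) P) := by
  have h : imU = coeffHom (RatFunc.X ^ 2) := by
    rw [imU, ← single_one_eq_tri]
    rfl
  rw [h, aeval_algHom_apply]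
  rfl

theorem algebraMap_eq_tri (c : ℂ) : algebraMap ℂ SkewAlg c = tri 0 (RatFunc.C c) 0 := by
  rw [← single_one_eq_tri, coe_algebraMap, Function.comp_apply, RatFunc.algebraMap_eq_C]

theorem tri_congr {a c b a' c' b' : RatFunc ℂ} (h1 : a = a') (h2 : c = c') (h3 : b = b') :
    tri a c b = tri a' c' b' := by rw [h1, h2, h3]

theorem quint_congr {a b c d e a' b' c' d' e' : RatFunc ℂ} (h1 : a = a') (h2 : b = b')
    (h3 : c = c') (h4 : d = d') (h5 : e = e') : quint a b c d e = quint a' b' c' d' e' := by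
  rw [h1, h2, h3, h4, h5]

/-! ### The four defining relations, compared coefficientwise -/

theorem tri_mul_imU (a c b : RatFunc ℂ) : tri a c b * imU =
    tri (a * (RatFunc.X + 1) ^ 2) (c * RatFunc.X ^ 2) (b * (RatFunc.X - 1) ^ 2) := by
  rw [imU, tri_mul_tri, tri_eq_quint]
  simp only [smul_pow', δ_smul_X, δ_inv_smul_X, smul_zero, mul_zero, add_zero, zero_add]

/-- The `δ⁰` coefficient of the relation for `[v,w]`: `a`, `b` stand for the two products of a
coefficient of `v` with a shifted one, and the last fraction is `p₁(x²) = (p(x) - p(-x))/2x`. -/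
theorem odd_part_identity {K : Type*} [Field K] [CharZero K] {x : K} (r a b : K) (hx : x ≠ 0)
    (h1 : 1 + 2 * x ≠ 0) (h2 : 1 - 2 * x ≠ 0) :
    (2 * x + 1) * a + (1 - 2 * x) * b = -a - b - (2 * r / ((1 + 2 * x) * (1 - 2 * x))) ^ 2 -
      (-4 * x * (x + 1) * a + r ^ 2 / (1 + 2 * x) ^ 2 -
        (4 * x * (1 - x) * b + r ^ 2 / (1 - 2 * x) ^ 2)) / (2 * x) := by
  field_simp
  ring

/-- The `δ⁰` coefficient of the relation for `w²`, with `p₀(x²) = (p(x) + p(-x))/2` on the right. -/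
theorem even_part_identity {K : Type*} [Field K] [CharZero K] {x : K} (r a b : K)
    (h1 : 1 + 2 * x ≠ 0) (h2 : 1 - 2 * x ≠ 0) :
    (2 * r / ((1 + 2 * x) * (1 - 2 * x))) ^ 2 * (3 / 4 - x ^ 2) -
      r * (2 * r / ((1 + 2 * x) * (1 - 2 * x))) - 2 * x * (x + 1) * a + 2 * x * (1 - x) * b =
      (-4 * x * (x + 1) * a + r ^ 2 / (1 + 2 * x) ^ 2 +
        (4 * x * (1 - x) * b + r ^ 2 / (1 - 2 * x) ^ 2)) / 2 := by
  field_simp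
  ring

/-- The `δ⁻¹` coefficient of the relation for `w²`, after removing the factor `a/2`; it links `c`
with its shift. -/
theorem shift_identity {K : Type*} [Field K] {x : K} (r : K)
    (h1 : 1 + 2 * x ≠ 0) (h2 : 1 - 2 * x ≠ 0) (h3 : 3 + 2 * x ≠ 0) :
    2 * r / ((1 + 2 * x) * (1 - 2 * x)) * ((x + 1) * (1 - 2 * x)) =
      2 * r + -2 * r / ((1 + 2 * x) * (3 + 2 * x)) * (x * (3 + 2 * x)) := by
  field_simp
  ring

theorem coeffV0_mul (q : ℂ[X]) :
    coeffV0 q * (1 - 4 * RatFunc.X ^ 2) = 2 * RatFunc.C (rho q) := by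
  obtain ⟨h1, h2, -⟩ := X_linear_ne_zero
  rw [coeffV0, div_mul_cancel₀]
  rw [one_sub_four_X_sq]
  exact mul_ne_zero h1 h2

/-- Commuting `x²` with `a δ⁻¹` multiplies `a` by `x² - (x+1)² = -(2x+1)`; this relation therefore
forces the image of `w` once that of `v` is chosen. -/
theorem imU_imV (q : ℂ[X]) : imU * imV q - imV q * imU = 2 * imW q + imV q := by
  rw [two_mul, imU, imV, imW]
  simp only [tri_mul_tri, tri_add]
  simp only [tri_eq_quint, quint_sub, smul_zero, smul_pow',
    δ_smul_X, δ_inv_smul_X]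
  apply quint_congr <;> ring

theorem imU_imW (q : ℂ[X]) : imU * imW q - imW q * imU =
    2 * imV q * imU + imW q + algebraMap ℂ SkewAlg (rho q) := by
  rw [two_mul, add_mul, imU, imV, imW, algebraMap_eq_tri]
  simp only [tri_mul_tri]
  simp only [tri_eq_quint, quint_add, quint_sub, smul_zero, smul_pow',
    δ_smul_X, δ_inv_smul_X]
  apply quint_congr
  · ring
  · ring
  -- A commutator with `x²` has no `δ⁰` term, so the relation reads `c(1-4x²) = 2ρ`, which
  -- determines `c`.
  · linear_combination (1 / 2) * coeffV0_mul q
  · ring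
  · ring

theorem imV_imW (q : ℂ[X]) : imV q * imW q - imW q * imV q =
    -(imV q) ^ 2 - aeval imU (polyP1 q) := by
  obtain ⟨h1, h2, h3, h4, h5, h6⟩ := X_linear_ne_zero
  have hX := ratFunc_X_ne_zero
  rw [aeval_imU, sq, imV, imW, aeval_polyP1, aeval_polyP, aeval_neg_polyP, single_one_eq_tri]
  simp only [tri_mul_tri]
  simp only [tri_eq_quint, quint_sub, quint_neg,
    δ_smul_X, δ_inv_smul_X, smul_mul', smul_neg, smul_add, smul_sub, smul_one, smul_div_ratFunc,
    smul_ofNat_ratFunc]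
  apply quint_congr
  · ring
  · rw [δ_inv_smul_coeffV0, coeffV0, one_sub_four_X_sq]
    field_simp
    ring
  -- Only the products `a·a₁` and `b·b₁` matter from here on, so the identity becomes one in a field
  -- with free variables.
  · generalize coeffV q = a
    generalize δ⁻¹ • negX a = a₁
    generalize negX a = b
    generalize δ • a = b₁
    rw [coeffV0, one_sub_four_X_sq]
    linear_combination odd_part_identity (RatFunc.C (rho q)) (a * a₁) (b * b₁) hX h1 h2
  · rw [δ_smul_coeffV0, coeffV0, one_sub_four_X_sq]
    field_simp
    ring
  · ring

theorem imW_sq (q : ℂ[X]) : imW q ^ 2 =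
    imV q ^ 2 * imU + imV q * imW q + rho q • imV q + aeval imU (polyP0 q) := by
  obtain ⟨h1, h2, h3, h4, h5, h6⟩ := X_linear_ne_zero
  have hX := ratFunc_X_ne_zero
  rw [aeval_imU, sq, sq, mul_assoc, imV, imW, aeval_polyP0, aeval_polyP, aeval_neg_polyP,
    single_one_eq_tri, tri_smul]
  simp only [tri_mul_imU]
  simp only [tri_mul_tri]
  simp only [tri_eq_quint, quint_add, smul_pow',
    δ_smul_X, δ_inv_smul_X, smul_mul', smul_neg, smul_add, smul_sub, smul_one, smul_div_ratFunc,
    smul_ofNat_ratFunc]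
  apply quint_congr
  · ring
  · rw [δ_inv_smul_coeffV0, coeffV0, one_sub_four_X_sq]
    linear_combination (coeffV q / 2) * shift_identity (RatFunc.C (rho q)) h1 h2 h3
  · generalize coeffV q = a
    generalize δ⁻¹ • negX a = a₁
    generalize negX a = b
    generalize δ • a = b₁
    rw [coeffV0, one_sub_four_X_sq]
    linear_combination even_part_identity (RatFunc.C (rho q)) (a * a₁) (b * b₁) h1 h2
  · rw [δ_smul_coeffV0, coeffV0, one_sub_four_X_sq]
    field_simp
    ring
  · ring

/-! ### A spanning set of `D(q)` -/

section Spanning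

variable (q : ℂ[X])

theorem gen_u_v : gen q .u * gen q .v = gen q .v * gen q .u + (2 * gen q .w + gen q .v) := by
  have h := RingQuot.mkAlgHom_rel ℂ (Rel.uv (q := q))
  rw [Ring.lie_def] at h
  simp only [map_sub, map_mul, map_add, map_ofNat] at h
  exact sub_eq_iff_eq_add'.1 h

theorem gen_u_w : gen q .u * gen q .w = gen q .w * gen q .u +
    (2 * gen q .v * gen q .u + gen q .w + algebraMap ℂ _ (rho q)) := by
  have h := RingQuot.mkAlgHom_rel ℂ (Rel.uw (q := q))
  rw [Ring.lie_def] at h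
  simp only [map_sub, map_mul, map_add, map_ofNat, AlgHom.commutes] at h
  exact sub_eq_iff_eq_add'.1 h

theorem gen_w_v : gen q .w * gen q .v = gen q .v * gen q .w +
    (gen q .v ^ 2 + aeval (gen q .u) (polyP1 q)) := by
  have h := RingQuot.mkAlgHom_rel ℂ (Rel.vw (q := q))
  rw [Ring.lie_def] at h
  simp only [map_sub, map_mul, map_neg, map_pow, ← aeval_algHom_apply] at h
  have h' : gen q .v * gen q .w - gen q .w * gen q .v =
    -gen q .v ^ 2 - aeval (gen q .u) (polyP1 q) := h
  rw [← sub_eq_iff_eq_add', ← neg_sub, h']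
  abel

theorem gen_w_sq : gen q .w * gen q .w = gen q .v ^ 2 * gen q .u + gen q .v * gen q .w +
    rho q • gen q .v + aeval (gen q .u) (polyP0 q) := by
  have h := RingQuot.mkAlgHom_rel ℂ (Rel.ww (q := q))
  simp only [map_add, map_mul, map_smul, map_pow, ← aeval_algHom_apply] at h
  rw [← sq]
  exact h

theorem adjoin_range_gen : Algebra.adjoin ℂ (Set.range (gen q)) = ⊤ := by
  have h : Set.range (gen q) =
      RingQuot.mkAlgHom ℂ (Rel q) '' Set.range (FreeAlgebra.ι ℂ) := by
    rw [← Set.range_comp]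
    rfl
  rw [h, ← AlgHom.map_adjoin, FreeAlgebra.adjoin_range_ι, Algebra.map_top, AlgHom.range_eq_top]
  exact RingQuot.mkAlgHom_surjective ℂ (Rel q)

/-- The span of the monomials `vʲ uⁱ` and `vᵏ w uⁱ` with `j, k + 1 ≤ n`. -/
def pbw : ℕ → Submodule ℂ (D q)
  | 0 => LinearMap.range (aeval (R := ℂ) (gen q .u)).toLinearMap
  | n + 1 => pbw n ⊔
      (LinearMap.range
        (LinearMap.mulLeft ℂ (gen q .v ^ (n + 1)) ∘ₗ (aeval (R := ℂ) (gen q .u)).toLinearMap) ⊔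
      LinearMap.range
        (LinearMap.mulLeft ℂ (gen q .v ^ n * gen q .w) ∘ₗ (aeval (R := ℂ) (gen q .u)).toLinearMap))

variable {q}

theorem mem_pbw_zero {x : D q} : x ∈ pbw q 0 ↔ ∃ P : ℂ[X], aeval (gen q .u) P = x := Iff.rfl

theorem mem_pbw_succ {n : ℕ} {x : D q} : x ∈ pbw q (n + 1) ↔ ∃ s ∈ pbw q n, ∃ P Q : ℂ[X],
    s + (gen q .v ^ (n + 1) * aeval (gen q .u) P +
      gen q .v ^ n * gen q .w * aeval (gen q .u) Q) = x := by
  simp only [pbw, Submodule.mem_sup, LinearMap.mem_range]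
  constructor
  · rintro ⟨s, hs, _, ⟨_, ⟨P, rfl⟩, _, ⟨Q, rfl⟩, rfl⟩, rfl⟩
    exact ⟨s, hs, P, Q, rfl⟩
  · rintro ⟨s, hs, P, Q, rfl⟩
    exact ⟨s, hs, _, ⟨_, ⟨P, rfl⟩, _, ⟨Q, rfl⟩, rfl⟩, rfl⟩

theorem pbw_le_succ (n : ℕ) : pbw q n ≤ pbw q (n + 1) := le_sup_left

theorem v_pow_mul_mem (n : ℕ) (P : ℂ[X]) : gen q .v ^ n * aeval (gen q .u) P ∈ pbw q n := by
  cases n with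
  | zero => exact mem_pbw_zero.2 ⟨P, by simp⟩
  | succ n => exact mem_pbw_succ.2 ⟨0, zero_mem _, P, 0, by simp⟩

theorem v_pow_mul_w_mul_mem (n : ℕ) (P : ℂ[X]) :
    gen q .v ^ n * gen q .w * aeval (gen q .u) P ∈ pbw q (n + 1) :=
  mem_pbw_succ.2 ⟨0, zero_mem _, 0, P, by simp⟩

theorem w_mul_mem (P : ℂ[X]) : gen q .w * aeval (gen q .u) P ∈ pbw q 1 := by
  simpa using v_pow_mul_w_mul_mem (q := q) 0 P

theorem v_mul_mem {n : ℕ} : ∀ {x : D q}, x ∈ pbw q n → gen q .v * x ∈ pbw q (n + 1) := by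
  induction n with
  | zero =>
    intro x hx
    obtain ⟨P, rfl⟩ := mem_pbw_zero.1 hx
    simpa using v_pow_mul_mem (q := q) 1 P
  | succ n ih =>
    intro x hx
    obtain ⟨s, hs, P, Q, rfl⟩ := mem_pbw_succ.1 hx
    refine mem_pbw_succ.2 ⟨gen q .v * s, ih hs, P, Q, ?_⟩
    rw [pow_succ' (gen q .v) (n + 1), mul_add, mul_add]
    conv_rhs => rw [← mul_assoc, ← mul_assoc, ← mul_assoc, ← pow_succ' (gen q .v) n]

theorem aeval_mul_mem {n : ℕ} (h : ∀ x ∈ pbw q n, gen q .u * x ∈ pbw q n) (P : ℂ[X]) :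
    ∀ x ∈ pbw q n, aeval (gen q .u) P * x ∈ pbw q n := by
  induction P using Polynomial.induction_on' with
  | add P Q hP hQ =>
    intro x hx
    rw [map_add, add_mul]
    exact add_mem (hP x hx) (hQ x hx)
  | monomial k c =>
    intro x hx
    rw [aeval_monomial, ← Algebra.smul_def, smul_mul_assoc]
    apply Submodule.smul_mem
    induction k with
    | zero => simpa using hx
    | succ k ih =>
      rw [pow_succ', mul_assoc]
      exact h _ ih

theorem u_mul_v_mul_mem {n : ℕ} (hu : ∀ x ∈ pbw q n, gen q .u * x ∈ pbw q n)
    (hw : ∀ x ∈ pbw q n, gen q .w * x ∈ pbw q (n + 1)) {x : D q} (hx : x ∈ pbw q n) :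
    gen q .u * (gen q .v * x) ∈ pbw q (n + 1) := by
  rw [← mul_assoc, gen_u_v, add_mul, add_mul, mul_assoc, two_mul, add_mul]
  exact add_mem (v_mul_mem (hu x hx)) (add_mem (add_mem (hw x hx) (hw x hx)) (v_mul_mem hx))

theorem w_mul_v_mul_mem {n : ℕ} (hu : ∀ x ∈ pbw q n, gen q .u * x ∈ pbw q n)
    (hw : ∀ x ∈ pbw q n, gen q .w * x ∈ pbw q (n + 1)) {x : D q} (hx : x ∈ pbw q n) :
    gen q .w * (gen q .v * x) ∈ pbw q (n + 2) := by
  rw [← mul_assoc, gen_w_v, add_mul, add_mul, mul_assoc, sq, mul_assoc]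
  exact add_mem (v_mul_mem (hw x hx)) (add_mem (v_mul_mem (v_mul_mem hx))
    (pbw_le_succ _ (pbw_le_succ _ (aeval_mul_mem hu _ x hx))))

theorem u_mul_w_mul_mem (P : ℂ[X]) : gen q .u * (gen q .w * aeval (gen q .u) P) ∈ pbw q 1 := by
  have h : gen q .u * (gen q .w * aeval (gen q .u) P) = gen q .w * aeval (gen q .u) (X * P + P) +
      gen q .v * aeval (gen q .u) (2 * X * P) + aeval (gen q .u) (rho q • P) := by
    rw [← mul_assoc, gen_u_w]
    rw [map_smul, Algebra.smul_def]
    simp only [map_add, map_mul, aeval_X, map_ofNat]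
    noncomm_ring
  rw [h]
  exact add_mem (add_mem (w_mul_mem _) (v_mul_mem (mem_pbw_zero.2 ⟨_, rfl⟩)))
    (pbw_le_succ 0 (mem_pbw_zero.2 ⟨_, rfl⟩))

theorem w_mul_w_mul_mem (P : ℂ[X]) : gen q .w * (gen q .w * aeval (gen q .u) P) ∈ pbw q 2 := by
  have h : gen q .w * (gen q .w * aeval (gen q .u) P) =
      gen q .v * (gen q .v * aeval (gen q .u) (X * P)) +
      gen q .v * (gen q .w * aeval (gen q .u) P) + gen q .v * aeval (gen q .u) (rho q • P) +
      aeval (gen q .u) (polyP0 q * P) := by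
    rw [← mul_assoc, gen_w_sq]
    simp only [map_mul, map_smul, aeval_X, add_mul, sq, mul_assoc, smul_mul_assoc, mul_smul_comm]
  rw [h]
  have h0 : ∀ R : ℂ[X], aeval (gen q .u) R ∈ pbw q 0 := fun R => mem_pbw_zero.2 ⟨R, rfl⟩
  exact add_mem (add_mem (add_mem (v_mul_mem (v_mul_mem (h0 _))) (v_mul_mem (w_mul_mem _)))
    (pbw_le_succ _ (v_mul_mem (h0 _)))) (pbw_le_succ _ (pbw_le_succ _ (h0 _)))

/-- The two claims need each other: moving `u` past `v` creates a `w`, and moving `w` past `v`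
creates a polynomial in `u`. -/
theorem u_mul_mem_and_w_mul_mem (n : ℕ) : (∀ x ∈ pbw q n, gen q .u * x ∈ pbw q n) ∧
    ∀ x ∈ pbw q n, gen q .w * x ∈ pbw q (n + 1) := by
  induction n with
  | zero =>
    constructor
    · intro x hx
      obtain ⟨P, rfl⟩ := mem_pbw_zero.1 hx
      exact mem_pbw_zero.2 ⟨X * P, by rw [map_mul, aeval_X]⟩
    · intro x hx
      obtain ⟨P, rfl⟩ := mem_pbw_zero.1 hx
      exact w_mul_mem P
  | succ n ih =>
    obtain ⟨hu, hw⟩ := ih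
    have hv : ∀ P : ℂ[X], gen q .v ^ (n + 1) * aeval (gen q .u) P =
        gen q .v * (gen q .v ^ n * aeval (gen q .u) P) := fun P => by rw [pow_succ', mul_assoc]
    have hvw : ∀ (m : ℕ) (P : ℂ[X]), gen q .v ^ (m + 1) * gen q .w * aeval (gen q .u) P =
        gen q .v * (gen q .v ^ m * gen q .w * aeval (gen q .u) P) := fun m P => by
      rw [pow_succ', mul_assoc, mul_assoc, mul_assoc]
    constructor
    · intro x hx
      obtain ⟨s, hs, P, Q, rfl⟩ := mem_pbw_succ.1 hx
      rw [mul_add, mul_add, hv]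
      refine add_mem (pbw_le_succ _ (hu s hs))
        (add_mem (u_mul_v_mul_mem hu hw (v_pow_mul_mem n P)) ?_)
      -- For `n = 0` the monomial `w Q(u)` has no `v` to pull out, so the relation between `u` and
      -- `w` is used directly.
      cases n with
      | zero => simpa using u_mul_w_mul_mem Q
      | succ m =>
        rw [hvw]
        exact u_mul_v_mul_mem hu hw (v_pow_mul_w_mul_mem m Q)
    · intro x hx
      obtain ⟨s, hs, P, Q, rfl⟩ := mem_pbw_succ.1 hx
      rw [mul_add, mul_add, hv]
      refine add_mem (pbw_le_succ _ (hw s hs))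
        (add_mem (w_mul_v_mul_mem hu hw (v_pow_mul_mem n P)) ?_)
      cases n with
      | zero => simpa using w_mul_w_mul_mem Q
      | succ m =>
        rw [hvw]
        exact w_mul_v_mul_mem hu hw (v_pow_mul_w_mul_mem m Q)

/-- Left multiplication by a generator raises the filtration by at most one, so the union of the
filtration is a left ideal; it contains `1`. -/
theorem exists_mem_pbw (x : D q) : ∃ n, x ∈ pbw q n := by
  have mono : Monotone (pbw q) := monotone_nat_of_le_succ pbw_le_succ
  have key : ∀ a : D q, ∀ n, ∀ y ∈ pbw q n, ∃ m, a * y ∈ pbw q m := by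
    intro a
    have ha : a ∈ Algebra.adjoin ℂ (Set.range (gen q)) := by
      rw [adjoin_range_gen]
      trivial
    induction ha using Algebra.adjoin_induction with
    | mem a ha =>
      intro n y hy
      obtain ⟨g, rfl⟩ := ha
      cases g with
      | u => exact ⟨n, (u_mul_mem_and_w_mul_mem n).1 y hy⟩
      | v => exact ⟨n + 1, v_mul_mem hy⟩
      | w => exact ⟨n + 1, (u_mul_mem_and_w_mul_mem n).2 y hy⟩
    | algebraMap c =>
      intro n y hy
      exact ⟨n, by rw [← Algebra.smul_def]; exact Submodule.smul_mem _ _ hy⟩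
    | add a b _ _ ha hb =>
      intro n y hy
      obtain ⟨k, hk⟩ := ha n y hy
      obtain ⟨l, hl⟩ := hb n y hy
      exact ⟨max k l, by
        rw [add_mul]
        exact add_mem (mono (le_max_left k l) hk) (mono (le_max_right k l) hl)⟩
    | mul a b _ _ ha hb =>
      intro n y hy
      obtain ⟨k, hk⟩ := hb n y hy
      rw [mul_assoc]
      exact ha k _ hk
  obtain ⟨m, hm⟩ := key x 0 1 (mem_pbw_zero.2 ⟨1, map_one _⟩)
  exact ⟨m, by rwa [mul_one] at hm⟩

end Spanning

/-! ### The homomorphism -/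

/-- The images of the generators of `D(q)`. -/
def imGen (q : ℂ[X]) : Gen → SkewAlg
  | .u => imU
  | .v => imV q
  | .w => imW q

/-- The homomorphism `D(q) → ℂ(x) # ℤ`. -/
def psi (q : ℂ[X]) : D q →ₐ[ℂ] SkewAlg :=
  RingQuot.liftAlgHom ℂ ⟨FreeAlgebra.lift ℂ (imGen q), by
    rintro _ _ (_ | _ | _ | _)
    · rw [Ring.lie_def]
      simp only [map_sub, map_mul, map_add, map_ofNat, FreeAlgebra.lift_ι_apply]
      exact imU_imV q
    · rw [Ring.lie_def]
      simp only [map_sub, map_mul, map_add, map_ofNat, FreeAlgebra.lift_ι_apply, AlgHom.commutes]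
      exact imU_imW q
    · rw [Ring.lie_def]
      simp only [map_sub, map_mul, map_neg, map_pow, ← aeval_algHom_apply,
        FreeAlgebra.lift_ι_apply]
      exact imV_imW q
    · simp only [map_add, map_mul, map_smul, map_pow, ← aeval_algHom_apply,
        FreeAlgebra.lift_ι_apply]
      exact imW_sq q⟩

theorem psi_gen (q : ℂ[X]) (g : Gen) : psi q (gen q g) = imGen q g := by
  rw [psi, gen, RingQuot.liftAlgHom_mkAlgHom_apply, FreeAlgebra.lift_ι_apply]

theorem psi_mem_of_imGen_mem (q : ℂ[X]) (A : Subalgebra ℂ SkewAlg) (h : ∀ g, imGen q g ∈ A)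
    (x : D q) : psi q x ∈ A := by
  have hx : x ∈ (Algebra.adjoin ℂ (Set.range (gen q))) := by
    rw [adjoin_range_gen]
    trivial
  have hle : Algebra.adjoin ℂ (Set.range (gen q)) ≤ A.comap (psi q) := by
    rw [Algebra.adjoin_le_iff]
    rintro _ ⟨g, rfl⟩
    simpa [psi_gen] using h g
  exact hle hx

theorem psi_mem_invariants (q : ℂ[X]) (x : D q) : psi q x ∈ invariants := by
  apply psi_mem_of_imGen_mem
  intro g
  rw [mem_invariants_iff]
  cases g with
  | u => simp [imGen, imU, tauHom_tri]
  | v => simp [imGen, imV, tauHom_tri, negX_coeffV0]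
  | w =>
    rw [imGen, imW, tauHom_tri]
    simp only [map_mul, map_neg, negX_negX, map_sub, map_add, map_one, negX_X, map_div₀,
      negX_coeffV0, map_ofNat, sub_neg_eq_add]
    apply tri_congr <;> ring

theorem psi_aeval_u (q : ℂ[X]) (P : ℂ[X]) :
    psi q (aeval (gen q .u) P) = single 1 (aeval (RatFunc.X ^ 2) P) := by
  rw [← aeval_algHom_apply, psi_gen, imGen, aeval_imU]

/-! ### Leading terms of the images -/

/-- The leading coefficient of the image of `vⁿ`. -/
def leadV (q : ℂ[X]) : ℕ → RatFunc ℂ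
  | 0 => 1
  | n + 1 => coeffV q * δ⁻¹ • leadV q n

theorem coeffV_ne_zero {q : ℂ[X]} (hq : q ≠ 0) : coeffV q ≠ 0 := by
  rw [coeffV, ← algebraMap_eq_aeval, add_comm]
  refine div_ne_zero ?_ (mul_ne_zero ratFunc_X_ne_zero X_linear_ne_zero.1)
  exact (map_ne_zero_iff _ (IsFractionRing.injective ℂ[X] (RatFunc ℂ))).2 hq

theorem leadV_ne_zero {q : ℂ[X]} (hq : q ≠ 0) (n : ℕ) : leadV q n ≠ 0 := by
  induction n with
  | zero => exact one_ne_zero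
  | succ n ih => exact mul_ne_zero (coeffV_ne_zero hq) (by rwa [Ne, smul_eq_zero_iff_eq])

theorem hasLead_v_pow (q : ℂ[X]) (n : ℕ) : HasLead n (leadV q n) (psi q (gen q .v ^ n)) := by
  induction n with
  | zero => simpa [leadV] using hasLead_one
  | succ n ih =>
    rw [pow_succ', map_mul, psi_gen]
    exact ih.tri_mul _ _ _

theorem hasLead_w (q : ℂ[X]) :
    HasLead 1 (-coeffV q * (RatFunc.X + 1)) (psi q (gen q .w)) := by
  rw [psi_gen, ← mul_one (imGen q .w)]
  have h := hasLead_one.tri_mul (-coeffV q * (RatFunc.X + 1)) (-coeffV0 q / 2)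
    (-negX (coeffV q) * (1 - RatFunc.X))
  rwa [smul_one, mul_one] at h

/-- At leading order `w` acts as `v` followed on the right by `-x`, because `-a(x+1) = a·δ⁻¹(-x)`.
-/
theorem hasLead_v_pow_mul_w (q : ℂ[X]) (n : ℕ) :
    HasLead (n + 1) (leadV q (n + 1) * (δ ^ (n + 1))⁻¹ • (-RatFunc.X))
      (psi q (gen q .v ^ n * gen q .w)) := by
  induction n with
  | zero =>
    have h := hasLead_w q
    rw [pow_zero, one_mul]
    convert h using 1
    rw [leadV, leadV, smul_one, mul_one, zero_add, pow_one, smul_neg, δ_inv_smul_X]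
    ring
  | succ n ih =>
    rw [pow_succ' (gen q .v), mul_assoc, map_mul, psi_gen]
    have h := ih.tri_mul (coeffV q) (coeffV0 q) (negX (coeffV q))
    rw [smul_mul', ← mul_smul, ← mul_inv_rev, ← pow_succ, ← mul_assoc] at h
    exact h

theorem exists_hasLead_of_mem_pbw {q : ℂ[X]} {n : ℕ} {x : D q} (hx : x ∈ pbw q n) :
    ∃ c, HasLead n c (psi q x) := by
  induction n generalizing x with
  | zero =>
    obtain ⟨P, rfl⟩ := mem_pbw_zero.1 hx
    refine ⟨_, by simpa [psi_aeval_u] using hasLead_one.mul_coeff (aeval (RatFunc.X ^ 2) P)⟩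
  | succ n ih =>
    obtain ⟨s, hs, P, Q, rfl⟩ := mem_pbw_succ.1 hx
    obtain ⟨c, hc⟩ := ih hs
    rw [map_add, map_add, map_mul, map_mul _ (gen q .v ^ n * gen q .w), psi_aeval_u, psi_aeval_u]
    exact ⟨_, hc.succ.add (((hasLead_v_pow q _).mul_coeff _).add
      ((hasLead_v_pow_mul_w q n).mul_coeff _))⟩

theorem eq_zero_of_mem_pbw {q : ℂ[X]} (hq : q ≠ 0) {n : ℕ} {x : D q} (hx : x ∈ pbw q n)
    (h : psi q x = 0) : x = 0 := by
  induction n generalizing x with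
  | zero =>
    obtain ⟨P, rfl⟩ := mem_pbw_zero.1 hx
    rw [psi_aeval_u, single_eq_zero] at h
    have := (eq_zero_of_even_sub_X_mul_even (P := P) (Q := 0) (by simpa using h)).1
    rw [this, map_zero]
  | succ n ih =>
    obtain ⟨s, hs, P, Q, rfl⟩ := mem_pbw_succ.1 hx
    obtain ⟨c, hc⟩ := exists_hasLead_of_mem_pbw hs
    have hl := hc.succ.add (((hasLead_v_pow q (n + 1)).mul_coeff (aeval (RatFunc.X ^ 2) P)).add
      ((hasLead_v_pow_mul_w q n).mul_coeff (aeval (RatFunc.X ^ 2) Q)))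
    rw [← psi_aeval_u q, ← psi_aeval_u q, ← map_mul, ← map_mul, ← map_add, ← map_add, h] at hl
    have h0 := hl.1
    -- The lead is factored as `leadV` times a shift of `P(x²) - xQ(x²)`; both the factor and the
    -- shift can be cancelled.
    rw [SkewMonoidAlgebra.coeff_zero, Finsupp.zero_apply, zero_add, mul_assoc, ← mul_add, ← smul_mul', ← smul_add]
      at h0
    have h1 := (mul_eq_zero.1 h0.symm).resolve_left (leadV_ne_zero hq _)
    rw [smul_eq_zero_iff_eq] at h1
    obtain ⟨rfl, rfl⟩ := eq_zero_of_even_sub_X_mul_even (P := P) (Q := Q)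
      (by rw [← h1]; ring)
    simp only [map_zero, mul_zero, add_zero] at h ⊢
    exact ih hs h

theorem psi_injective {q : ℂ[X]} (hq : q ≠ 0) : Function.Injective (psi q) := by
  rw [injective_iff_map_eq_zero]
  intro x hx
  obtain ⟨n, hn⟩ := exists_mem_pbw x
  exact eq_zero_of_mem_pbw hq hn hx

/-! ### Generation over the even rational functions -/

theorem mem_evenRat_iff {Y : SkewAlg} : Y ∈ evenRat ↔ ∃ f, negX f = f ∧ single 1 f = Y := by
  constructor
  · rintro ⟨f, hf, rfl⟩
    exact ⟨f, mem_adjoin_X_sq_iff.1 hf, rfl⟩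
  · rintro ⟨f, hf, rfl⟩
    exact ⟨f, mem_adjoin_X_sq_iff.2 hf, rfl⟩

theorem evenRat_le_invariants : evenRat ≤ invariants := by
  intro Y hY
  obtain ⟨f, hf, rfl⟩ := mem_evenRat_iff.1 hY
  rw [mem_invariants_iff, tauHom_single, inv_one, hf]

theorem range_psi_le_invariants (q : ℂ[X]) : (psi q).range ≤ invariants := by
  rintro _ ⟨x, rfl⟩
  exact psi_mem_invariants q x

theorem mul_toSubmodule_le {A B C : Subalgebra ℂ SkewAlg} (hA : A ≤ C) (hB : B ≤ C) :
    Subalgebra.toSubmodule A * Subalgebra.toSubmodule B ≤ Subalgebra.toSubmodule C :=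
  Submodule.mul_le.2 fun _ ha _ hb => C.mul_mem (hA ha) (hB hb)

theorem evenRat_mul_range_psi {q : ℂ[X]} (hq : q ≠ 0) :
    Subalgebra.toSubmodule evenRat * Subalgebra.toSubmodule (psi q).range =
      Subalgebra.toSubmodule invariants := by
  apply eq_of_forall_hasLead (mul_toSubmodule_le evenRat_le_invariants (range_psi_le_invariants q))
  · intro f hf
    rw [← mul_one (single 1 f : SkewAlg)]
    exact Submodule.mul_mem_mul (mem_evenRat_iff.2 ⟨f, hf, rfl⟩)
      ((Subalgebra.mem_toSubmodule _).2 (one_mem _))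
  · intro n f
    have hV := leadV_ne_zero hq (n + 1)
    obtain ⟨h₀, h₁, e₀, e₁, h⟩ := exists_even_add_X_mul_even (f / leadV q (n + 1))
    rw [div_eq_iff hV] at h
    have hc : ∃ k : ℂ, (δ ^ (n + 1))⁻¹ • (-RatFunc.X : RatFunc ℂ) =
        -RatFunc.X + RatFunc.C k := by
      refine ⟨((δ ^ (n + 1))⁻¹).toAdd, ?_⟩
      rw [smul_neg, shift_smul_X]
      ring
    obtain ⟨k, hk⟩ := hc
    -- Left coefficients are not shifted but the `-x` coming from `w` is, to `-x + k`; the term `k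
    -- h₁` compensates.
    have hl := ((hasLead_v_pow q (n + 1)).coeff_mul (h₀ + RatFunc.C k * h₁)).add
      ((hasLead_v_pow_mul_w q n).coeff_mul (-h₁))
    have e : (h₀ + RatFunc.C k * h₁) * leadV q (n + 1) +
        -h₁ * (leadV q (n + 1) * (δ ^ (n + 1))⁻¹ • (-RatFunc.X)) = f := by
      rw [h, hk]
      ring
    rw [e] at hl
    refine ⟨_, add_mem (Submodule.mul_mem_mul (mem_evenRat_iff.2 ⟨_, ?_, rfl⟩) ⟨_, rfl⟩)
      (Submodule.mul_mem_mul (mem_evenRat_iff.2 ⟨_, ?_, rfl⟩) ⟨_, rfl⟩), hl⟩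
    · rw [map_add, map_mul, negX_C, e₀, e₁]
    · rw [map_neg, e₁]

theorem range_psi_mul_evenRat {q : ℂ[X]} (hq : q ≠ 0) :
    Subalgebra.toSubmodule (psi q).range * Subalgebra.toSubmodule evenRat =
      Subalgebra.toSubmodule invariants := by
  apply eq_of_forall_hasLead (mul_toSubmodule_le (range_psi_le_invariants q) evenRat_le_invariants)
  · intro f hf
    rw [← one_mul (single 1 f : SkewAlg)]
    exact Submodule.mul_mem_mul ((Subalgebra.mem_toSubmodule _).2 (one_mem _)) (mem_evenRat_iff.2 ⟨f, hf, rfl⟩)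
  · intro n f
    have hV := leadV_ne_zero hq (n + 1)
    obtain ⟨h₀, h₁, e₀, e₁, h⟩ :=
      -- Right coefficients get shifted by `δ⁻ⁿ⁻¹`, as does `-x`, so the target is shifted back
      -- before splitting and no correction is needed.
      exists_even_add_X_mul_even ((δ ^ (n + 1)) • (f / leadV q (n + 1)))
    rw [smul_eq_iff_eq_inv_smul, div_eq_iff hV] at h
    have hl := ((hasLead_v_pow q (n + 1)).mul_coeff h₀).add
      ((hasLead_v_pow_mul_w q n).mul_coeff (-h₁))
    have e : leadV q (n + 1) * (δ ^ (n + 1))⁻¹ • h₀ +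
        leadV q (n + 1) * (δ ^ (n + 1))⁻¹ • (-RatFunc.X) * (δ ^ (n + 1))⁻¹ • (-h₁) = f := by
      rw [h, smul_add, smul_mul', smul_neg, smul_neg]
      ring
    rw [e] at hl
    refine ⟨_, add_mem (Submodule.mul_mem_mul ⟨_, rfl⟩ (mem_evenRat_iff.2 ⟨_, e₀, rfl⟩))
      (Submodule.mul_mem_mul ⟨_, rfl⟩ (mem_evenRat_iff.2 ⟨_, ?_, rfl⟩)), hl⟩
    rw [map_neg, e₁]

/-! ### Preservation of the even polynomials -/

theorem natAct_add (Y Z : SkewAlg) (f : RatFunc ℂ) :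
    GaloisOrder.natAct (Y + Z) f = GaloisOrder.natAct Y f + GaloisOrder.natAct Z f := by
  rw [map_add]
  rfl

theorem negX_natAct (Y : SkewAlg) (f : RatFunc ℂ) :
    negX (GaloisOrder.natAct Y f) = GaloisOrder.natAct (tauHom Y) (negX f) := by
  induction Y using SkewMonoidAlgebra.induction_on with
  | zero =>
    rw [map_zero, map_zero]
    exact map_zero _
  | single k g => simp [negX_smul]
  | add a b ha hb => rw [map_add tauHom, natAct_add, natAct_add, map_add, ha, hb]

/-- Invariance under `τ` makes the result even automatically. -/
theorem mem_preserving {Y : SkewAlg} (hY : Y ∈ invariants)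
    (h : ∀ g : ℂ[X], GaloisOrder.natAct Y (aeval (RatFunc.X ^ 2) g) ∈ polySubring) :
    Y ∈ preserving := by
  intro f hf
  obtain ⟨g, rfl⟩ := mem_evenPoly_iff.1 hf
  refine mem_evenPoly_iff_negX.2 ⟨h g, ?_⟩
  rw [negX_natAct, negX_aeval_X_sq, mem_invariants_iff.1 hY]

theorem aeval_mem_polySubring (P : ℂ[X]) : aeval (RatFunc.X : RatFunc ℂ) P ∈ polySubring :=
  ⟨P, algebraMap_eq_aeval P⟩

theorem aeval_neg_X_mem_polySubring (P : ℂ[X]) :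
    aeval (-RatFunc.X : RatFunc ℂ) P ∈ polySubring := by
  have h := aeval_mem_polySubring (P.comp (-X))
  rwa [aeval_comp, map_neg, aeval_X] at h

theorem C_mul_mem_polySubring (c : ℂ) {f : RatFunc ℂ} (hf : f ∈ polySubring) :
    RatFunc.C c * f ∈ polySubring :=
  mul_mem ⟨C c, RatFunc.algebraMap_C c⟩ hf

theorem C_half : (RatFunc.C (1 / 2) : RatFunc ℂ) = 1 / 2 := by
  rw [map_div₀, map_one, map_ofNat]

theorem half_add_X_ne_zero : (1 / 2 + RatFunc.X : RatFunc ℂ) ≠ 0 := by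
  rw [← C_half, add_comm]
  exact X_add_C_ne_zero _

theorem half_sub_X_ne_zero : (1 / 2 - RatFunc.X : RatFunc ℂ) ≠ 0 := by
  have h : (1 / 2 - RatFunc.X : RatFunc ℂ) = negX (1 / 2 + RatFunc.X) := by
    rw [map_add, negX_X, ← C_half, negX_C, sub_eq_add_neg]
  rw [h]
  exact (map_ne_zero negX).2 half_add_X_ne_zero

theorem negX_coeffV (q : ℂ[X]) :
    negX (coeffV q) = aeval (-RatFunc.X) q / (-RatFunc.X * (1 - 2 * RatFunc.X)) := by
  simp only [coeffV, map_div₀, map_mul, negX_aeval, negX_X, map_add, map_one, map_ofNat]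
  congr 1
  ring

theorem C_rho (q : ℂ[X]) : RatFunc.C (rho q) = 2 * RatFunc.C (q.eval (-1 / 2)) := by
  rw [rho, map_mul, map_ofNat]

theorem neg_imV_sub_imW (q : ℂ[X]) : -imV q - imW q =
    tri (1 / 2 * (aeval RatFunc.X q / (1 / 2 + RatFunc.X)))
      (1 / 2 * -(RatFunc.C (q.eval (-1 / 2)) / ((1 / 2 + RatFunc.X) * (1 / 2 - RatFunc.X))))
      (1 / 2 * (aeval (-RatFunc.X) q / (1 / 2 - RatFunc.X))) := by
  obtain ⟨h1, h2, -⟩ := X_linear_ne_zero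
  have hX := ratFunc_X_ne_zero
  have h3 : (1 / 2 + RatFunc.X : RatFunc ℂ) = (1 + 2 * RatFunc.X) / 2 := by ring
  have h4 : (1 / 2 - RatFunc.X : RatFunc ℂ) = (1 - 2 * RatFunc.X) / 2 := by ring
  rw [imV, imW, tri_neg, tri_sub, negX_coeffV, h3, h4, coeffV, coeffV0, C_rho, one_sub_four_X_sq,
    show (2 * RatFunc.X + 1 : RatFunc ℂ) = 1 + 2 * RatFunc.X by ring]
  apply tri_congr
  · field_simp
    ring
  · field_simp
    ring
  · field_simp
    ring

theorem neg_half_imV_sub_imW (q : ℂ[X]) : -(1 / 2 : ℂ) • imV q - imW q =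
    tri (1 / 2 * (aeval RatFunc.X q / RatFunc.X)) 0
      (1 / 2 * (aeval (-RatFunc.X) q / (-RatFunc.X))) := by
  obtain ⟨h1, h2, -⟩ := X_linear_ne_zero
  have hX := ratFunc_X_ne_zero
  rw [imV, imW, neg_smul, tri_smul, tri_neg, tri_sub, C_half, negX_coeffV, coeffV, coeffV0,
    show (2 * RatFunc.X + 1 : RatFunc ℂ) = 1 + 2 * RatFunc.X by ring]
  apply tri_congr
  · field_simp
    ring
  · ring
  · field_simp
    ring

/-- By partial fractions the value at `g(x²)` is `(H(x) + H(-x))/2`, where `H = (q(x)g((x+1)²) -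
q(-1/2)g(x²))/(x+1/2)`. This is a polynomial since `(x+1)² = x²` at `x = -1/2`. -/
theorem neg_imV_sub_imW_mem_preserving (q : ℂ[X]) (h : -imV q - imW q ∈ invariants) :
    -imV q - imW q ∈ preserving := by
  refine mem_preserving h fun g => ?_
  rw [neg_imV_sub_imW, natAct_tri, smul_aeval, smul_aeval, smul_pow', smul_pow', δ_smul_X,
    δ_inv_smul_X]
  set κ := q.eval (-1 / 2) with hκ
  have hroot : (q * g.comp ((X + 1) ^ 2) - C κ * g.comp (X ^ 2)).IsRoot (-(1 / 2)) := by
    have e1 : (-(1 / 2) + 1 : ℂ) ^ 2 = (-(1 / 2)) ^ 2 := by norm_num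
    simp only [IsRoot, eval_sub, eval_mul, eval_comp, eval_pow, eval_add, eval_X, eval_one, eval_C,
      e1, hκ, neg_div, sub_self]
  obtain ⟨H, hH⟩ := dvd_iff_isRoot.2 hroot
  have hp := congrArg (aeval (RatFunc.X : RatFunc ℂ)) hH
  have hm := congrArg (aeval (-RatFunc.X : RatFunc ℂ)) hH
  simp only [map_sub, map_mul, aeval_comp, map_pow, map_add, aeval_X, map_one, aeval_C,
    RatFunc.algebraMap_eq_C, map_neg, sub_neg_eq_add, C_half, neg_sq] at hp hm
  have e2 : (-RatFunc.X + 1 : RatFunc ℂ) ^ 2 = (RatFunc.X - 1) ^ 2 := by ring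
  rw [e2] at hm
  have h1 := half_add_X_ne_zero
  have h2 := half_sub_X_ne_zero
  have e3 : 1 / 2 * (aeval RatFunc.X q / (1 / 2 + RatFunc.X)) * aeval ((RatFunc.X + 1) ^ 2) g +
      1 / 2 * -(RatFunc.C κ / ((1 / 2 + RatFunc.X) * (1 / 2 - RatFunc.X))) *
        aeval (RatFunc.X ^ 2) g +
      1 / 2 * (aeval (-RatFunc.X) q / (1 / 2 - RatFunc.X)) * aeval ((RatFunc.X - 1) ^ 2) g =
      RatFunc.C (1 / 2) * (aeval RatFunc.X H + aeval (-RatFunc.X) H) := by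
    have hp' : aeval RatFunc.X H = (aeval RatFunc.X q * aeval ((RatFunc.X + 1) ^ 2) g -
        RatFunc.C κ * aeval (RatFunc.X ^ 2) g) / (1 / 2 + RatFunc.X) := by
      rw [hp, add_comm (1 / 2), mul_div_cancel_left₀]
      rwa [add_comm]
    have hm' : aeval (-RatFunc.X) H = (aeval (-RatFunc.X) q * aeval ((RatFunc.X - 1) ^ 2) g -
        RatFunc.C κ * aeval (RatFunc.X ^ 2) g) / (1 / 2 - RatFunc.X) := by
      rw [hm, sub_eq_neg_add, mul_div_cancel_left₀]
      rwa [← sub_eq_neg_add]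
    have e4 : 1 / ((1 / 2 + RatFunc.X) * (1 / 2 - RatFunc.X)) =
        (1 / (1 / 2 + RatFunc.X) + 1 / (1 / 2 - RatFunc.X) : RatFunc ℂ) := by
      rw [div_add_div _ _ h1 h2]
      congr 1
      ring
    rw [hp', hm', C_half]
    linear_combination (-1 / 2 * RatFunc.C κ * aeval (RatFunc.X ^ 2 : RatFunc ℂ) g) * e4
  rw [e3]
  exact C_mul_mem_polySubring _
    (add_mem (aeval_mem_polySubring H) (aeval_neg_X_mem_polySubring H))

/-- The value at `g(x²)` is half of `F(x) - F(-x)` over `x`, with `F = q(x)g((x+1)²)`; the numerator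
vanishes at `0`. -/
theorem neg_half_imV_sub_imW_mem_preserving (q : ℂ[X])
    (h : -(1 / 2 : ℂ) • imV q - imW q ∈ invariants) :
    -(1 / 2 : ℂ) • imV q - imW q ∈ preserving := by
  refine mem_preserving h fun g => ?_
  rw [neg_half_imV_sub_imW, natAct_tri, smul_aeval, smul_aeval, smul_pow', smul_pow', δ_smul_X,
    δ_inv_smul_X]
  have hroot : (q * g.comp ((X + 1) ^ 2) - (q * g.comp ((X + 1) ^ 2)).comp (-X)).IsRoot 0 := by
    simp [IsRoot, eval_comp]
  obtain ⟨H, hH⟩ := dvd_iff_isRoot.2 hroot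
  have hp := congrArg (aeval (RatFunc.X : RatFunc ℂ)) hH
  simp only [map_sub, map_mul, aeval_comp, map_pow, map_add, aeval_X, map_one, map_zero, sub_zero,
    map_neg] at hp
  have e2 : (-RatFunc.X + 1 : RatFunc ℂ) ^ 2 = (RatFunc.X - 1) ^ 2 := by ring
  rw [e2] at hp
  have hX := ratFunc_X_ne_zero
  have e3 : 1 / 2 * (aeval RatFunc.X q / RatFunc.X) * aeval ((RatFunc.X + 1) ^ 2) g +
      0 * aeval (RatFunc.X ^ 2) g +
      1 / 2 * (aeval (-RatFunc.X) q / (-RatFunc.X)) * aeval ((RatFunc.X - 1) ^ 2) g =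
      RatFunc.C (1 / 2) * aeval (RatFunc.X : RatFunc ℂ) H := by
    have hp' : aeval (RatFunc.X : RatFunc ℂ) H = (aeval RatFunc.X q * aeval ((RatFunc.X + 1) ^ 2) g -
        aeval (-RatFunc.X) q * aeval ((RatFunc.X - 1) ^ 2) g) / RatFunc.X := by
      rw [hp, mul_div_cancel_left₀ _ hX]
    rw [hp', C_half]
    ring
  rw [e3]
  exact C_mul_mem_polySubring _ (aeval_mem_polySubring H)

theorem psi_mem_preserving (q : ℂ[X]) (x : D q) : psi q x ∈ preserving := by
  have hv : imV q ∈ invariants := by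
    have h := psi_mem_invariants q (gen q .v)
    rwa [psi_gen] at h
  have hw : imW q ∈ invariants := by
    have h := psi_mem_invariants q (gen q .w)
    rwa [psi_gen] at h
  have hA := neg_imV_sub_imW_mem_preserving q (sub_mem (neg_mem hv) hw)
  have hB := neg_half_imV_sub_imW_mem_preserving q
    (sub_mem (Subalgebra.smul_mem _ hv _) hw)
  have hV : imV q = (2 : ℂ) • ((-(1 / 2 : ℂ) • imV q - imW q) - (-imV q - imW q)) := by
    rw [sub_sub_sub_cancel_right, smul_sub, smul_smul, smul_neg, two_smul ℂ]
    norm_num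
  have hV' : imV q ∈ preserving := by
    rw [hV]
    exact Subalgebra.smul_mem _ (sub_mem hB hA) _
  have hW : imW q = -(-imV q - imW q) - imV q := by abel
  apply psi_mem_of_imGen_mem
  intro g
  cases g with
  | u =>
    intro f hf
    rw [imGen, imU, natAct_tri, zero_mul, zero_mul, zero_add, add_zero]
    exact mul_mem (Algebra.self_mem_adjoin_singleton ℂ _) hf
  | v => exact hV'
  | w =>
    rw [imGen, hW]
    exact sub_mem (neg_mem hA) hV'

/-! ### The Galois order setting -/

theorem mem_S2_iff {w : RingAut SkewAlg} : w ∈ S2 ↔ w = 1 ∨ w = (tau : SkewAlg ≃+* SkewAlg) := by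
  have hsq : (tau : SkewAlg ≃+* SkewAlg) * (tau : SkewAlg ≃+* SkewAlg) = (1 : RingAut SkewAlg) :=
    RingEquiv.ext fun Y => tauHom_tauHom Y
  constructor
  · intro hw
    obtain ⟨k, rfl⟩ := Subgroup.mem_zpowers_iff.1 hw
    rw [← sq, ← zpow_natCast] at hsq
    rcases Int.even_or_odd' k with ⟨m, rfl | rfl⟩
    · left
      rw [zpow_mul]
      exact (congrArg (· ^ m) hsq).trans (one_zpow m)
    · right
      rw [zpow_add, zpow_one, zpow_mul]
      exact (congrArg (· ^ m * _) hsq).trans (by rw [one_zpow, one_mul])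
  · rintro (rfl | rfl)
    · exact one_mem _
    · exact Subgroup.mem_zpowers _

theorem mem_fixedSubring_S2 {Y : SkewAlg} : Y ∈ GaloisOrder.fixedSubring S2 ↔ Y ∈ invariants := by
  constructor
  · intro h
    exact h _ (mem_S2_iff.2 (Or.inr rfl))
  · intro h w hw
    rcases mem_S2_iff.1 hw with rfl | rfl
    · rfl
    · exact h

theorem mem_fixedCoeff_S2 {f : RatFunc ℂ} : f ∈ GaloisOrder.fixedCoeff S2 ↔ negX f = f := by
  have h : f ∈ GaloisOrder.fixedCoeff S2 ↔ (single 1 f : SkewAlg) ∈ GaloisOrder.fixedSubring S2 :=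
    Iff.rfl
  rw [h, mem_fixedSubring_S2, mem_invariants_iff, tauHom_single, inv_one]
  exact (single_injective 1).eq_iff

theorem mem_polySubring_inf_fixedCoeff {f : RatFunc ℂ} :
    f ∈ polySubring ⊓ GaloisOrder.fixedCoeff S2 ↔ f ∈ evenPoly := by
  rw [mem_evenPoly_iff_negX, ← mem_fixedCoeff_S2]
  rfl

/-- `ℂ[x]` is isomorphic to its image in `ℂ(x)`. -/
def polyEquiv : ℂ[X] ≃+* polySubring :=
  RingEquiv.ofBijective (algebraMap ℂ[X] (RatFunc ℂ)).rangeRestrict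
    ⟨fun _ _ h => IsFractionRing.injective ℂ[X] (RatFunc ℂ) (congrArg Subtype.val h),
      RingHom.rangeRestrict_surjective _⟩

theorem isSetting : GaloisOrder.IsSetting polySubring S2 where
  noetherian := isNoetherianRing_of_ringEquiv ℂ[X] polyEquiv
  integrallyClosed := IsIntegrallyClosed.of_equiv polyEquiv
  fractionRing := by
    refine IsFractionRing.of_field polySubring (RatFunc ℂ) fun f => ?_
    obtain ⟨P, Q, -, rfl⟩ := IsFractionRing.div_surjective (A := ℂ[X]) f
    exact ⟨polyEquiv P, polyEquiv Q, rfl⟩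
  map_smul := by
    have hle : ∀ μ : Multiplicative ℤ, ∀ f ∈ polySubring, μ • f ∈ polySubring := by
      rintro μ _ ⟨P, rfl⟩
      refine ⟨polyShift μ P, ?_⟩
      rw [shift_smul_def, IsFractionRing.fieldEquivOfAlgEquivHom_apply,
        IsFractionRing.fieldEquivOfAlgEquiv_algebraMap]
    intro μ
    apply le_antisymm
    · rintro _ ⟨f, hf, rfl⟩
      exact hle μ f hf
    · intro f hf
      exact ⟨μ⁻¹ • f, hle _ f hf, smul_inv_smul μ f⟩
  faithful := by
    intro μ ν h
    have h1 := h RatFunc.X ⟨X, RatFunc.algebraMap_X⟩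
    rw [shift_smul_X, shift_smul_X, sub_right_inj] at h1
    exact Multiplicative.toAdd.injective (by exact_mod_cast RatFunc.C_injective h1)
  finite := by
    have h : (S2 : Set (RingAut SkewAlg)) ⊆ {1, (tau : SkewAlg ≃+* SkewAlg)} :=
      fun w hw => mem_S2_iff.1 hw
    exact ((Set.toFinite _).subset h).to_subtype
  preserves_coeff := by
    rintro w hw _ ⟨P, rfl⟩
    rcases mem_S2_iff.1 hw with rfl | rfl
    · exact ⟨_, ⟨P, rfl⟩, rfl⟩
    · refine ⟨negX (algebraMap ℂ[X] (RatFunc ℂ) P), ?_, ?_⟩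
      · rw [algebraMap_eq_aeval, negX_aeval, negX_X]
        exact aeval_neg_X_mem_polySubring P
      · refine (tauHom_single 1 _).trans ?_
        rw [inv_one]
        rfl
  preserves_monoid := by
    intro w hw μ
    rcases mem_S2_iff.1 hw with rfl | rfl
    · exact ⟨μ, rfl⟩
    · refine ⟨μ⁻¹, ?_⟩
      rw [of_apply, of_apply]
      refine (tauHom_single μ _).trans ?_
      rw [map_one]

theorem isPrincipalGaloisOrder_range_psi {q : ℂ[X]} (hq : q ≠ 0) :
    GaloisOrder.IsPrincipalGaloisOrder polySubring S2 (psi q).range.toSubring where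
  toIsSetting := isSetting
  coeff_le := by
    rintro _ ⟨f, hf, rfl⟩
    obtain ⟨g, rfl⟩ := mem_evenPoly_iff.1 (mem_polySubring_inf_fixedCoeff.1 hf)
    exact ⟨aeval (gen q .u) g, psi_aeval_u q g⟩
  le_fixed := by
    rintro _ ⟨x, rfl⟩
    exact mem_fixedSubring_S2.2 (psi_mem_invariants q x)
  preserves := by
    rintro _ ⟨x, rfl⟩ f hf
    exact mem_polySubring_inf_fixedCoeff.2
      (psi_mem_preserving q x f (mem_polySubring_inf_fixedCoeff.1 hf))
  span_eq := by
    apply le_antisymm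
    · rw [AddSubgroup.closure_le]
      rintro _ ⟨f, hf, _, ⟨x, rfl⟩, rfl⟩
      exact mul_mem (s := GaloisOrder.fixedSubring S2) hf
        (mem_fixedSubring_S2.2 (psi_mem_invariants q x))
    · intro Y hY
      have hY' : Y ∈ Subalgebra.toSubmodule evenRat * Subalgebra.toSubmodule (psi q).range := by
        rw [evenRat_mul_range_psi hq]
        exact mem_fixedSubring_S2.1 hY
      refine Submodule.mul_induction_on hY' ?_ fun a b ha hb => add_mem ha hb
      intro a ha X hX
      obtain ⟨f, hf, rfl⟩ := mem_evenRat_iff.1 ha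
      exact AddSubgroup.subset_closure ⟨f, mem_fixedCoeff_S2.2 hf, X, hX, rfl⟩

end KleinianD
end

/-! ### Assembly of the theorem -/

theorem theorem1p1 (q : ℂ[X]) (hq : 4 ≤ q.natDegree) :
    ∃ φ : D q →ₐ[ℂ] invariants,
      Function.Injective φ ∧
      (φ (gen q .u) : SkewAlg) = single 1 (RatFunc.X ^ 2) ∧
      (φ (-gen q .v - gen q .w) : SkewAlg) =
        (1 / 2 : ℂ) •
          (single δ⁻¹ (aeval RatFunc.X q / (1 / 2 + RatFunc.X)) +
            single δ (aeval (-RatFunc.X) q / (1 / 2 - RatFunc.X)) -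
            single 1 (RatFunc.C (q.eval (-1 / 2)) /
              ((1 / 2 + RatFunc.X) * (1 / 2 - RatFunc.X)))) ∧
      (φ (-(1 / 2 : ℂ) • gen q .v - gen q .w) : SkewAlg) =
        (1 / 2 : ℂ) •
          (single δ⁻¹ (aeval RatFunc.X q / RatFunc.X) +
            single δ (aeval (-RatFunc.X) q / (-RatFunc.X))) ∧
      Subalgebra.toSubmodule evenRat * Subalgebra.toSubmodule (invariants.val.comp φ).range =
        Subalgebra.toSubmodule invariants ∧
      Subalgebra.toSubmodule (invariants.val.comp φ).range * Subalgebra.toSubmodule evenRat =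
        Subalgebra.toSubmodule invariants ∧
      (invariants.val.comp φ).range ≤ invariants ⊓ preserving ∧
      GaloisOrder.IsPrincipalGaloisOrder polySubring S2
        (invariants.val.comp φ).range.toSubring := by
  have hq0 : q ≠ 0 := by
    rintro rfl
    simp at hq
  have hval : invariants.val.comp ((psi q).codRestrict invariants (psi_mem_invariants q)) = psi q :=
    AlgHom.val_comp_codRestrict _ _ _
  refine ⟨(psi q).codRestrict invariants (psi_mem_invariants q),
    (AlgHom.injective_codRestrict _ _ _).2 (psi_injective hq0), ?_, ?_, ?_, ?_, ?_, ?_, ?_⟩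
  · refine (psi_gen q .u).trans ?_
    rw [imGen, imU, single_one_eq_tri]
  · change psi q _ = _
    rw [map_sub, map_neg, psi_gen, psi_gen]
    refine (neg_imV_sub_imW q).trans ?_
    simp only [tri, smul_add, smul_sub, smul_single, RatFunc.smul_eq_C_mul, C_half, mul_neg,
      single_neg]
    abel
  · change psi q _ = _
    rw [map_sub, map_smul, psi_gen, psi_gen]
    refine (neg_half_imV_sub_imW q).trans ?_
    simp only [tri, smul_add, smul_single, RatFunc.smul_eq_C_mul, C_half, single_zero, add_zero]
  · rw [hval]
    exact evenRat_mul_range_psi hq0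
  · rw [hval]
    exact range_psi_mul_evenRat hq0
  · rw [hval]
    rintro _ ⟨x, rfl⟩
    exact ⟨psi_mem_invariants q x, psi_mem_preserving q x⟩
  · rw [hval]
    exact isPrincipalGaloisOrder_range_psi hq0
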